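/- Let $0<q<1$ and $l\ge \tfrac14$. Put $(a;q)_n=\prod_{j=0}^{n-1}(1-aq^j)$, $(a;q)_\infty=\prod_{r\ge 0}(1-aq^r)$, $[a]_q=\frac{q^{a/2}-q^{-a/2}}{q^{1/2}-q^{-1/2}}$, $c_n=\prod_{k=1}^n\left([2l+k-1]_q/[k]_q\right)^{1/2}$ and $f_n(x)=c_nx^n$ $(n\ge 0)$. Let $\mathcal H_l$ be the complex Hilbert space of power series $f=\sum_n a_nf_n$ with $\sum_n|a_n|^2<\infty$, in which $(f_n)$ is an orthonormal basis. For $n\ge0$ and $y=\cos\theta$ let $$P_n^{(\alpha)}(y|q)=\frac{(q^{\alpha+1};q)_n}{(q;q)_n}\sum_{k=0}^n\frac{(q^{-n};q)_k\,(q^{\alpha/2+1/4}e^{i\theta};q)_k\,(q^{\alpha/2+1/4}e^{-i\theta};q)_k}{(q^{\alpha+1};q)_k\,(q;q)_k}\,q^k$$ be the continuous $q$-Laguerre polynomials, and put, with $\nu=\cos\theta=1-(q^{-1/2}-q^{1/2})\lambda$, $$p_n(\lambda)=q^{(1/4-l)n}\,\frac{(q;q)_n^{1/2}}{(q^{2l};q)_n^{1/2}}\,P_n^{(2l-1)}(\nu|q),\qquad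 \xi_\lambda^l(x)=\frac{(q^{l/2}x;q)_\infty\,(q^{(l+1)/2}x;q)_\infty}{(q^{(1-2l)/4}e^{i\theta}x;q)_\infty\,(q^{(1-2l)/4}e^{-i\theta}x;q)_\infty}.$$ On $[0,2q^{1/2}/(1-q)]$ let $$\hat w(\lambda)=\frac{(q;q)_\infty(q^{2l};q)_\infty}{2\pi}\sqrt{\frac{1-q}{\lambda q^{1/2}}}\;\frac{w(1-q^{-1/2}(1-q)\lambda)}{\sqrt{2-q^{-1/2}(1-q)\lambda}},\qquad w(\cos\theta)=\left|\frac{(e^{i\theta};q^{1/2})_\infty(-e^{i\theta};q^{1/2})_\infty}{(q^{l-1/4}e^{i\theta};q^{1/2})_\infty}\right|^2 .$$ Then for every $\lambda\in[0,2q^{1/2}/(1-q)]$ and every complex $x$ with $|x|<q^{(2l-1)/4}$ one has $\xi^l_\lambda(x)=\sum_{n\ge0}p_n(\lambda)f_n(x)$. The polynomials $p_n$ belong to $L^2([0,2q^{1/2}/(1-q)],\hat w(\lambda)d\lambda)$, for every $f=\sum_n a_nf_n\in\mathcal H_l$ the series $$F(\lambda)=\langle f,\xi_\lambda^l\rangle:=\sum_{n\ge0}a_n\,p_n(\lambda)$$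 converges in that space, and $f\mapsto F$ is a linear isometry from $\mathcal H_l$ onto $L^2([0,2q^{1/2}/(1-q)],\hat w(\lambda)d\lambda)$. -/

import Mathlib

open MeasureTheory
open scoped ENNReal PowerSeries

noncomputable section

namespace QLaguerre

/-- The finite `q`-shifted factorial `(a;q)_n = (1-a)(1-aq)⋯(1-aq^{n-1})`. -/
def qPoch {K : Type*} [CommRing K] (a q : K) (n : ℕ) : K :=
  ∏ j ∈ Finset.range n, (1 - a * q ^ j)

/-- The infinite `q`-shifted factorial `(a;q)_∞ = ∏_{r ≥ 0} (1-aq^r)`. -/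
def qPochInf {K : Type*} [CommRing K] [TopologicalSpace K] (a q : K) : K :=
  ∏' r : ℕ, (1 - a * q ^ r)

/-- The `q`-number `[a]_q = (q^{a/2}-q^{-a/2})/(q^{1/2}-q^{-1/2})`. -/
def qNum (q a : ℝ) : ℝ :=
  (q ^ (a / 2) - q ^ (-a / 2)) / (q ^ (1 / 2 : ℝ) - q ^ (-1 / 2 : ℝ))

/-- `c_n^l(q) = ∏_{k=1}^n [2l+k-1]_q^{1/2} / [k]_q^{1/2}`, the normalization of the monomial `x^n`. -/
def c (q l : ℝ) (n : ℕ) : ℝ :=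
  ∏ k ∈ Finset.Icc 1 n, √(qNum q (2 * l + k - 1)) / √(qNum q k)

/-- Admissible parameters of a discrete series representation. -/
def Admissible (q l : ℝ) : Prop := 0 < q ∧ q < 1 ∧ 0 < l

lemma admissible_of_quarter_le {q l : ℝ} (h0 : 0 < q) (h1 : q < 1) (hl : 1 / 4 ≤ l) :
    Admissible q l :=
  ⟨h0, h1, by linarith⟩

lemma qNum_pos {q a : ℝ} (h0 : 0 < q) (h1 : q < 1) (ha : 0 < a) : 0 < qNum q a := by
  unfold qNum
  apply div_pos_of_neg_of_neg
  · exact sub_neg.2 (Real.rpow_lt_rpow_of_exponent_gt h0 h1 (by linarith))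
  · exact sub_neg.2 (Real.rpow_lt_rpow_of_exponent_gt h0 h1 (by norm_num))

lemma c_pos {q l : ℝ} (h : Admissible q l) (n : ℕ) : 0 < c q l n := by
  obtain ⟨h0, h1, hl⟩ := h
  refine Finset.prod_pos fun k hk => ?_
  have hk : (1 : ℝ) ≤ k := by exact_mod_cast (Finset.mem_Icc.1 hk).1
  exact div_pos (Real.sqrt_pos.2 (qNum_pos h0 h1 (by linarith)))
    (Real.sqrt_pos.2 (qNum_pos h0 h1 (by linarith)))

/-- The coefficient `b_n` of `f = ∑ b_n f_n^l` with respect to the basis `f_n^l = c_n^l(q) x^n`. -/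
def bcoef (q l : ℝ) (n : ℕ) : ℂ⟦X⟧ →ₗ[ℂ] ℂ := ((c q l n : ℂ)⁻¹) • PowerSeries.coeff n

lemma memlp_iff (a : ℕ → ℂ) : Memℓp a 2 ↔ Summable fun n => ‖a n‖ ^ 2 := by
  rw [memℓp_gen_iff (by norm_num)]
  norm_num

/-- The space `H_l` of the power series `f = ∑ b_n f_n^l` with `∑ |b_n|^2 < ∞`. -/
def Hl (q l : ℝ) (_h : Admissible q l) : Submodule ℂ ℂ⟦X⟧ where
  carrier := {f | Summable fun n => ‖bcoef q l n f‖ ^ 2}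
  zero_mem' := by simp
  add_mem' := by
    intro f g hf hg
    have hf' := (memlp_iff _).2 hf
    have hg' := (memlp_iff _).2 hg
    refine (memlp_iff _).1 ?_
    convert hf'.add hg' using 1
    ext n; simp
  smul_mem' := by
    intro r f hf
    have hf' := (memlp_iff _).2 hf
    refine (memlp_iff _).1 ?_
    convert hf'.const_smul r using 1
    ext n; simp

/-- The coordinate map `f = ∑ b_n f_n^l ↦ (b_n)_n` from `H_l` into `ℓ²`. -/
def Hl.coord (q l : ℝ) (h : Admissible q l) : Hl q l h →ₗ[ℂ] lp (fun _ : ℕ => ℂ) 2 where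
  toFun f := ⟨fun n => bcoef q l n f.1, (memlp_iff _).2 f.2⟩
  map_add' f g := by
    ext n
    simp
    rfl
  map_smul' r f := by ext n; simp

lemma Hl.coord_injective (q l : ℝ) (h : Admissible q l) : Function.Injective (Hl.coord q l h) := by
  intro f g hfg
  ext n
  have := congrArg (fun v : lp (fun _ : ℕ => ℂ) 2 => v n) hfg
  have hc : (c q l n : ℂ) ≠ 0 := by exact_mod_cast (c_pos h n).ne'
  simpa [Hl.coord, bcoef, hc] using this

/-- `‖f‖² = ∑ |b_n|²`, see `Hl.norm_sq`. -/
instance (q l : ℝ) (h : Admissible q l) : NormedAddCommGroup (Hl q l h) :=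
  NormedAddCommGroup.induced _ _ (Hl.coord q l h) (Hl.coord_injective q l h)

/-- `⟨f, g⟩ = ∑ b_n(g) * conj b_n(f)`, linear in the second argument, see `Hl.inner_eq`. -/
instance (q l : ℝ) (h : Admissible q l) : InnerProductSpace ℂ (Hl q l h) where
  norm_smul_le r f := by
    change ‖Hl.coord q l h (r • f)‖ ≤ ‖r‖ * ‖Hl.coord q l h f‖
    rw [map_smul, norm_smul]
  inner f g := inner ℂ (Hl.coord q l h f) (Hl.coord q l h g)
  norm_sq_eq_re_inner f := norm_sq_eq_re_inner (𝕜 := ℂ) (Hl.coord q l h f)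
  conj_inner_symm f g := inner_conj_symm _ _
  add_left f g k := by rw [map_add, inner_add_left]
  smul_left f g r := by rw [map_smul, inner_smul_left]

lemma Hl.inner_eq {q l : ℝ} {h : Admissible q l} (f g : Hl q l h) :
    inner ℂ f g = ∑' n, bcoef q l n g.1 * starRingEnd ℂ (bcoef q l n f.1) :=
  lp.inner_eq_tsum (Hl.coord q l h f) (Hl.coord q l h g)

lemma Hl.norm_sq {q l : ℝ} {h : Admissible q l} (f : Hl q l h) :
    ‖f‖ ^ 2 = ∑' n, ‖bcoef q l n f.1‖ ^ 2 := by
  have := lp.norm_rpow_eq_tsum (p := 2) (by norm_num) (Hl.coord q l h f)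
  norm_num at this
  exact this

/-- The continuous `q`-Laguerre polynomial
`P_n^{(α)}(y|q) = (q^{α+1};q)_n/(q;q)_n *
  ₃φ₂(q^{-n}, q^{α/2+1/4} e^{iθ}, q^{α/2+1/4} e^{-iθ}; q^{α+1}, 0; q, q)`, `y = cos θ`,
where the two middle factors are multiplied out:
`(A e^{iθ};q)_k (A e^{-iθ};q)_k = ∏_{j<k} (1 - 2 A q^j y + A² q^{2j})`. -/
def P (q α : ℝ) (n : ℕ) (y : ℝ) : ℝ :=
  qPoch (q ^ (α + 1)) q n / qPoch q q n *
    ∑ k ∈ Finset.range (n + 1),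
      qPoch ((q ^ n)⁻¹) q k *
        (∏ j ∈ Finset.range k,
          (1 - 2 * q ^ (α / 2 + 1 / 4) * q ^ j * y + (q ^ (α / 2 + 1 / 4) * q ^ j) ^ 2)) /
        (qPoch (q ^ (α + 1)) q k * qPoch q q k) * q ^ k

/-- `ν = cos θ = 1 - (q^{-1/2} - q^{1/2}) λ`. -/
def nu (q t : ℝ) : ℝ := 1 - (q ^ (-1 / 2 : ℝ) - q ^ (1 / 2 : ℝ)) * t

/-- `e^{iθ}` for `y = cos θ`, `0 ≤ θ ≤ π`. -/
def expTheta (y : ℝ) : ℂ := Complex.exp (Complex.I * Real.arccos y)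

/-- The normalized polynomials
`p_n(λ) = q^{(1/4-l)n} (q;q)_n^{1/2} (q^{2l};q)_n^{-1/2} P_n^{(2l-1)}(ν|q)`. -/
def p (q l : ℝ) (n : ℕ) (t : ℝ) : ℝ :=
  q ^ ((1 / 4 - l) * n) * √(qPoch q q n) / √(qPoch (q ^ (2 * l)) q n) * P q (2 * l - 1) n (nu q t)

/-- The generalized eigenfunction
`ξ_λ^l(x;q) = (q^{l/2}x;q)_∞ (q^{(l+1)/2}x;q)_∞
  / ((q^{(1-2l)/4}e^{iθ}x;q)_∞ (q^{(1-2l)/4}e^{-iθ}x;q)_∞)`. -/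
def xi (q l t : ℝ) (x : ℂ) : ℂ :=
  qPochInf (((q ^ (l / 2) : ℝ) : ℂ) * x) (q : ℂ) *
      qPochInf (((q ^ ((l + 1) / 2) : ℝ) : ℂ) * x) (q : ℂ) /
    (qPochInf (((q ^ ((1 - 2 * l) / 4) : ℝ) : ℂ) * expTheta (nu q t) * x) (q : ℂ) *
      qPochInf (((q ^ ((1 - 2 * l) / 4) : ℝ) : ℂ) * (expTheta (nu q t))⁻¹ * x) (q : ℂ))

/-- `w(y) = |(e^{iθ};q^{1/2})_∞ (-e^{iθ};q^{1/2})_∞ / (q^{l-1/4}e^{iθ};q^{1/2})_∞|²`. -/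
def w (q l y : ℝ) : ℝ :=
  ‖qPochInf (expTheta y) ((√q : ℝ) : ℂ) * qPochInf (-expTheta y) ((√q : ℝ) : ℂ) /
    qPochInf (((q ^ (l - 1 / 4) : ℝ) : ℂ) * expTheta y) ((√q : ℝ) : ℂ)‖ ^ 2

/-- The weight `ŵ(λ)`. -/
def what (q l t : ℝ) : ℝ :=
  1 / (2 * Real.pi) * qPochInf q q * qPochInf (q ^ (2 * l)) q *
    √((1 - q) / (t * q ^ (1 / 2 : ℝ))) *
    (w q l (1 - q ^ (-1 / 2 : ℝ) * (1 - q) * t) / √(2 - q ^ (-1 / 2 : ℝ) * (1 - q) * t))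

/-- The right end point `2 q^{1/2}/(1-q)` of the interval. -/
def endpt (q : ℝ) : ℝ := 2 * q ^ (1 / 2 : ℝ) / (1 - q)

/-- The measure `ŵ(λ) dλ` on `[0, 2 q^{1/2}/(1-q)]`. -/
def weightMeasure (q l : ℝ) : Measure ℝ :=
  (volume.restrict (Set.Icc 0 (endpt q))).withDensity fun t => ENNReal.ofReal (what q l t)

end QLaguerre

end

noncomputable section

namespace QLaguerre

open Filter Topology

/-! ### Finite and infinite q-shifted factorials. -/

section qPochhammer

/-! Put a = q^(l-1/4) and b = q^(l+1/4), so that ab = q^(2l). The continuous q-Laguerre polynomials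
are a^n times the Al-Salam–Chihara polynomials `asc a b q` (`P_eq_asc`), and the power of q in p_n
removes this a^n. Hence p_n is `asc` up to a square root, and the inverse square root sits in c_n.
The expansion of ξ is therefore the Al-Salam–Chihara generating function (`hasSum_asc`), a product
of two q-binomial series.

The isometry amounts to the p_n being a Hilbert basis. Under λ = (1 - cos θ)/(q^(-1/2) - q^(1/2))
the weight becomes `ascWeight` on (0, π) (`w_cos`, `deriv_lam_mul_what`), extended evenly to a full
period so that Fourier series apply. By the three-term recurrence, orthogonality to constants and
the total mass determine all inner products (`integral_asc_mul_asc`).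

The case a = b = 0 (continuous q-Hermite) follows from the finite Jacobi triple product
(`integral_hermite`). Expanding both kernels 1/|(ae^{iθ};q)_∞|² and 1/|(be^{iθ};q)_∞|² in q-Hermite
polynomials gives the mass for |a|, |b| < 1; a = 1, which is l = 1/4, is a limit
(`integral_ascWeight`). Multiplying the weight by |(ae^{iθ};q)_k|² replaces a by aq^k, so the ₃φ₂
formula turns the integral of `asc` into a terminating sum that vanishes
(`integral_asc_mul_ascWeight`).

Completeness holds because the weight is a finite measure on a compact interval: continuous
functions are dense in L², Weierstrass approximation applies, and the recurrence puts all
polynomials in the span of the p_n (`span_toLp_dense`, `polynomial_mem_span_p`). -/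

lemma qPoch_succ {K : Type*} [CommRing K] (a q : K) (n : ℕ) :
    qPoch a q (n + 1) = qPoch a q n * (1 - a * q ^ n) := Finset.prod_range_succ _ _

lemma qPoch_succ' {K : Type*} [CommRing K] (a q : K) (n : ℕ) :
    qPoch a q (n + 1) = (1 - a) * qPoch (a * q) q n := by
  simp only [qPoch, Finset.prod_range_succ', pow_zero, mul_one]
  rw [mul_comm]
  congr 1
  exact Finset.prod_congr rfl fun j _ => by ring

lemma qPoch_add {K : Type*} [CommRing K] (a q : K) (m n : ℕ) :
    qPoch a q (m + n) = qPoch a q m * qPoch (a * q ^ m) q n := by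
  simp only [qPoch, Finset.prod_range_add]
  congr 1
  exact Finset.prod_congr rfl fun j _ => by ring

lemma qPoch_pos {q a : ℝ} (h0 : 0 < q) (h1 : q < 1) (ha : a < 1) (n : ℕ) : 0 < qPoch a q n := by
  refine Finset.prod_pos fun j _ => ?_
  have h : q ^ j ≤ 1 := pow_le_one₀ h0.le h1.le
  have h' : 0 < q ^ j := pow_pos h0 j
  rcases le_total a 0 with h2 | h2
  · nlinarith
  · nlinarith

variable {K : Type*} [NormedField K]

lemma summable_norm_neg_mul_pow {q : K} (hq : ‖q‖ < 1) (a : K) :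
    Summable fun r : ℕ => ‖-(a * q ^ r)‖ := by
  simp only [norm_neg, norm_mul, norm_pow]
  exact (summable_geometric_of_lt_one (norm_nonneg q) hq).mul_left _

lemma qPoch_ne_zero {q a : K} (hq : ‖q‖ < 1) (ha : ‖a‖ < 1) (n : ℕ) : qPoch a q n ≠ 0 := by
  refine Finset.prod_ne_zero_iff.2 fun j _ h => ?_
  have h2 : ‖a * q ^ j‖ = 1 := by rw [← sub_eq_zero.1 h, norm_one]
  rw [norm_mul, norm_pow] at h2
  have := pow_le_one₀ (n := j) (norm_nonneg q) hq.le
  nlinarith [norm_nonneg a, norm_nonneg q, pow_nonneg (norm_nonneg q) j]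

lemma qPochInf_zero (q : K) : qPochInf 0 q = 1 := by simp [qPochInf]

variable [CompleteSpace K]

lemma multipliable_one_sub_mul_pow {q : K} (hq : ‖q‖ < 1) (a : K) :
    Multipliable fun r : ℕ => 1 - a * q ^ r := by
  simpa [sub_eq_add_neg] using multipliable_one_add_of_summable (summable_norm_neg_mul_pow hq a)

lemma tendsto_qPoch {q : K} (hq : ‖q‖ < 1) (a : K) :
    Tendsto (qPoch a q) atTop (𝓝 (qPochInf a q)) :=
  (multipliable_one_sub_mul_pow hq a).hasProd.tendsto_prod_nat

lemma qPochInf_eq_qPoch_mul {q : K} (hq : ‖q‖ < 1) (a : K) (n : ℕ) :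
    qPochInf a q = qPoch a q n * qPochInf (a * q ^ n) q := by
  have h := (tendsto_qPoch hq (a * q ^ n)).const_mul (qPoch a q n)
  simp only [← qPoch_add] at h
  refine tendsto_nhds_unique ((tendsto_qPoch hq a).comp (tendsto_add_atTop_nat n)) ?_
  simpa [Function.comp_def, add_comm] using h

lemma qPochInf_eq_mul {q : K} (hq : ‖q‖ < 1) (a : K) :
    qPochInf a q = (1 - a) * qPochInf (a * q) q := by
  simpa [qPoch] using qPochInf_eq_qPoch_mul hq a 1

lemma qPochInf_ne_zero' {q : K} (hq : ‖q‖ < 1) {a : K} (ha : ∀ r : ℕ, 1 - a * q ^ r ≠ 0) :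
    qPochInf a q ≠ 0 := by
  have := tprod_one_add_ne_zero_of_summable (f := fun r : ℕ => -(a * q ^ r))
    (fun r => by simpa [sub_eq_add_neg] using ha r) (summable_norm_neg_mul_pow hq a)
  simpa [qPochInf, sub_eq_add_neg] using this

lemma qPochInf_ne_zero {q : K} (hq : ‖q‖ < 1) {a : K} (ha : ‖a‖ < 1) :
    qPochInf a q ≠ 0 := by
  refine qPochInf_ne_zero' hq fun r h => ?_
  have h2 : ‖a * q ^ r‖ = 1 := by rw [← sub_eq_zero.1 h, norm_one]
  rw [norm_mul, norm_pow] at h2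
  have := pow_le_one₀ (n := r) (norm_nonneg q) hq.le
  nlinarith [norm_nonneg a, norm_nonneg q, pow_nonneg (norm_nonneg q) r]

lemma continuous_qPochInf {q : K} (hq : ‖q‖ < 1) : Continuous fun a : K => qPochInf a q := by
  refine continuous_iff_continuousAt.2 fun a => ?_
  have := tendsto_tprod_one_add_of_dominated_convergence (𝓕 := 𝓝 a)
    (f := fun a (r : ℕ) => -(a * q ^ r)) (g := fun r : ℕ => -(a * q ^ r))
    (bound := fun r => (‖a‖ + 1) * ‖q‖ ^ r)
    ((summable_geometric_of_lt_one (norm_nonneg q) hq).mul_left _)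
    (fun r => ((continuous_id.mul continuous_const).neg.tendsto a)) ?_
  · simpa [ContinuousAt, qPochInf, sub_eq_add_neg] using this
  · filter_upwards [Metric.ball_mem_nhds a one_pos] with x hx r
    rw [norm_neg, norm_mul, norm_pow]
    gcongr
    have := norm_sub_norm_le x a
    rw [mem_ball_iff_norm] at hx
    linarith

/-- Together with `qPochInf_even_odd`, this converts the weight from base q^(1/2) to base q in
`w_cos`. -/
lemma qPochInf_sq {q : K} (hq : ‖q‖ < 1) (a : K) :
    qPochInf a q * qPochInf (-a) q = qPochInf (a ^ 2) (q ^ 2) := by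
  have hq2 : ‖q ^ 2‖ < 1 := by rw [norm_pow]; exact pow_lt_one₀ (norm_nonneg _) hq two_ne_zero
  refine tendsto_nhds_unique ((tendsto_qPoch hq a).mul (tendsto_qPoch hq (-a))) ?_
  refine (tendsto_qPoch hq2 (a ^ 2)).congr fun n => ?_
  simp only [qPoch, ← Finset.prod_mul_distrib]
  exact Finset.prod_congr rfl fun j _ => by ring

lemma qPochInf_even_odd {q : K} (hq : ‖q‖ < 1) (a : K) :
    qPochInf a (q ^ 2) * qPochInf (a * q) (q ^ 2) = qPochInf a q := by
  have hq2 : ‖q ^ 2‖ < 1 := by rw [norm_pow]; exact pow_lt_one₀ (norm_nonneg _) hq two_ne_zero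
  refine tendsto_nhds_unique ((tendsto_qPoch hq2 a).mul (tendsto_qPoch hq2 (a * q))) ?_
  refine ((tendsto_qPoch hq a).comp (tendsto_id.const_mul_atTop' two_pos)).congr fun n => ?_
  simp only [Function.comp, id]
  induction n with
  | zero => simp [qPoch]
  | succ n ih =>
    have e : 2 * (n + 1) = 2 * n + 1 + 1 := rfl
    rw [e, qPoch_succ, qPoch_succ, ih, qPoch_succ, qPoch_succ]
    ring

end qPochhammer

lemma ofReal_qPochInf {q : ℝ} (h0 : 0 < q) (h1 : q < 1) (a : ℝ) :
    ((qPochInf a q : ℝ) : ℂ) = qPochInf (a : ℂ) (q : ℂ) := by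
  have hq : ‖q‖ < 1 := by rwa [Real.norm_of_nonneg h0.le]
  have hq' : ‖(q : ℂ)‖ < 1 := by rwa [Complex.norm_real]
  refine tendsto_nhds_unique ((Complex.continuous_ofReal.tendsto _).comp (tendsto_qPoch hq a)) ?_
  refine (tendsto_qPoch hq' (a : ℂ)).congr fun n => ?_
  simp [qPoch]

lemma conj_qPochInf {q : ℝ} (h0 : 0 < q) (h1 : q < 1) (a : ℂ) :
    starRingEnd ℂ (qPochInf a (q : ℂ)) = qPochInf (starRingEnd ℂ a) (q : ℂ) := by
  have hq' : ‖(q : ℂ)‖ < 1 := by rwa [Complex.norm_real, Real.norm_of_nonneg h0.le]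
  refine tendsto_nhds_unique ((Complex.continuous_conj.tendsto _).comp (tendsto_qPoch hq' a)) ?_
  refine (tendsto_qPoch hq' (starRingEnd ℂ a)).congr fun n => ?_
  simp [qPoch]

lemma qPochInf_pos {q a : ℝ} (h0 : 0 < q) (h1 : q < 1) (ha : |a| < 1) : 0 < qPochInf a q := by
  have hq : ‖q‖ < 1 := by rwa [Real.norm_of_nonneg h0.le]
  refine lt_of_le_of_ne ?_ (qPochInf_ne_zero hq ha).symm
  exact ge_of_tendsto' (tendsto_qPoch hq a) fun n => (qPoch_pos h0 h1 (abs_lt.1 ha).2 n).le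

/-! ### The q-binomial theorem. -/

section qBinomial

/-- The coefficients `∏_{j<n} (z - bq^j)/(1-q^{j+1})` of `(bt;q)_∞/(zt;q)_∞`. -/
def qBinomCoeff {K : Type*} [Field K] (z b q : K) (n : ℕ) : K :=
  ∏ j ∈ Finset.range n, (z - b * q ^ j) / (1 - q ^ (j + 1))

variable {K : Type*} [NormedField K]

lemma one_sub_pow_succ_ne_zero {q : K} (hq : ‖q‖ < 1) (n : ℕ) : 1 - q ^ (n + 1) ≠ 0 := by
  intro h
  have h2 : ‖q ^ (n + 1)‖ = 1 := by rw [← sub_eq_zero.1 h, norm_one]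
  rw [norm_pow] at h2
  exact (pow_lt_one₀ (norm_nonneg q) hq n.succ_ne_zero).ne h2

lemma qBinomCoeff_zero (z b q : K) : qBinomCoeff z b q 0 = 1 := by simp [qBinomCoeff]

lemma qBinomCoeff_succ {q : K} (hq : ‖q‖ < 1) (z b : K) (n : ℕ) :
    (1 - q ^ (n + 1)) * qBinomCoeff z b q (n + 1) = (z - b * q ^ n) * qBinomCoeff z b q n := by
  rw [qBinomCoeff, Finset.prod_range_succ, ← qBinomCoeff]
  have := one_sub_pow_succ_ne_zero hq n
  field_simp

/-- Ratio test: consecutive terms have ratio tending to zt. -/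
lemma summable_norm_qBinomCoeff {q : K} (hq : ‖q‖ < 1) (z b : K) {t : K} (ht : ‖z * t‖ < 1) :
    Summable fun n => ‖qBinomCoeff z b q n * t ^ n‖ := by
  obtain ⟨ρ, h1, h2⟩ := exists_between ht
  have hpow := tendsto_pow_atTop_nhds_zero_of_norm_lt_one hq
  have hlim : Tendsto (fun n : ℕ => ‖(z - b * q ^ n) / (1 - q ^ (n + 1)) * t‖) atTop
      (𝓝 ‖z * t‖) := by
    have := ((((hpow.const_mul b).const_sub z).div
      ((hpow.comp (tendsto_add_atTop_nat 1)).const_sub 1) (by simp)).mul_const t).norm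
    simpa using this
  refine summable_of_ratio_norm_eventually_le (r := ρ) h2 ?_
  filter_upwards [hlim.eventually_lt_const h1] with n hn
  rw [norm_norm, norm_norm, qBinomCoeff, Finset.prod_range_succ, ← qBinomCoeff, pow_succ]
  calc _ = ‖(z - b * q ^ n) / (1 - q ^ (n + 1)) * t‖ * ‖qBinomCoeff z b q n * t ^ n‖ := by
        rw [← norm_mul]; congr 1; ring
    _ ≤ _ := by gcongr

variable [CompleteSpace K]

/-- The `q`-binomial theorem. -/
lemma hasSum_qBinomCoeff {q : K} (hq : ‖q‖ < 1) (z b : K) {t : K} (ht : ‖z * t‖ < 1) :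
    HasSum (fun n => qBinomCoeff z b q n * t ^ n) (qPochInf (b * t) q / qPochInf (z * t) q) := by
  have hS : ∀ {s : K}, ‖z * s‖ < 1 → Summable fun n => qBinomCoeff z b q n * s ^ n :=
    fun hs => (summable_norm_qBinomCoeff hq z b hs).of_norm
  have hle : ∀ N : ℕ, ‖q ^ N‖ ≤ 1 := fun N => by
    rw [norm_pow]; exact pow_le_one₀ (norm_nonneg q) hq.le
  have htN : ∀ N : ℕ, ‖z * (t * q ^ N)‖ < 1 := fun N => by
    rw [← mul_assoc, norm_mul]
    nlinarith [hle N, norm_nonneg (z * t), norm_nonneg (q ^ N)]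
  set F : K → K := fun s => ∑' n, qBinomCoeff z b q n * s ^ n with hF
  -- The coefficient recurrence is equivalent to this functional equation; iterating it along s =
  -- tq^N, where F tends to its constant term 1, produces the two infinite products.
  have key : ∀ s, ‖z * s‖ < 1 → ‖z * (s * q)‖ < 1 → (1 - z * s) * F s = (1 - b * s) * F (s * q) := by
    intro s hs hs'
    have e1 : F s = 1 + ∑' n, qBinomCoeff z b q (n + 1) * s ^ (n + 1) := by
      rw [hF]; simp only
      rw [(hS hs).tsum_eq_zero_add]; simp [qBinomCoeff_zero]
    have e2 : F (s * q) = 1 + ∑' n, qBinomCoeff z b q (n + 1) * (s * q) ^ (n + 1) := by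
      rw [hF]; simp only
      rw [(hS hs').tsum_eq_zero_add]; simp [qBinomCoeff_zero]
    have s1 := (hS hs).comp_injective (add_left_injective 1)
    have s2 := (hS hs').comp_injective (add_left_injective 1)
    simp only [Function.comp_def] at s1 s2
    have e3 : F s - F (s * q) = z * s * F s - b * s * F (s * q) := by
      rw [e1, e2, add_sub_add_left_eq_sub, ← s1.tsum_sub s2, ← e1, ← e2, hF]
      simp only
      rw [← tsum_mul_left, ← tsum_mul_left, ← ((hS hs).mul_left _).tsum_sub ((hS hs').mul_left _)]
      congr 1
      ext n
      have := qBinomCoeff_succ hq z b n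
      linear_combination s ^ (n + 1) * this
    linear_combination e3
  have iter : ∀ N, qPoch (z * t) q N * F t = qPoch (b * t) q N * F (t * q ^ N) := by
    intro N
    induction N with
    | zero => simp [qPoch]
    | succ N ih =>
      rw [qPoch_succ, qPoch_succ]
      have := key (t * q ^ N) (htN N) (by rw [mul_assoc, ← pow_succ]; exact htN (N + 1))
      rw [mul_assoc t, ← pow_succ] at this
      linear_combination (1 - z * t * q ^ N) * ih + qPoch (b * t) q N * this
  have hlim : Tendsto (fun N : ℕ => F (t * q ^ N)) atTop (𝓝 1) := by
    have : (1 : K) = ∑' n, (if n = 0 then 1 else 0) := by simp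
    rw [this]
    refine tendsto_tsum_of_dominated_convergence (summable_norm_qBinomCoeff hq z b ht)
      (fun n => ?_) (Eventually.of_forall fun N n => ?_)
    · rcases eq_or_ne n 0 with rfl | hn
      · simp [qBinomCoeff_zero]
      · simp only [hn, if_false]
        have h := tendsto_pow_atTop_nhds_zero_of_norm_lt_one hq
        have := (((h.const_mul t).pow n).const_mul (qBinomCoeff z b q n))
        simpa [hn] using this
    · rw [mul_pow, ← mul_assoc, norm_mul (_ * _)]
      refine mul_le_of_le_one_right (norm_nonneg _) ?_
      rw [norm_pow]; exact pow_le_one₀ (norm_nonneg _) (hle N)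
  have hfin : qPochInf (z * t) q * F t = qPochInf (b * t) q * 1 :=
    tendsto_nhds_unique (((tendsto_qPoch hq (z * t)).mul_const (F t)).congr iter)
      ((tendsto_qPoch hq (b * t)).mul hlim)
  have : F t = qPochInf (b * t) q / qPochInf (z * t) q := by
    rw [eq_div_iff (qPochInf_ne_zero hq ht)]; linear_combination hfin
  rw [← this]
  exact (hS ht).hasSum

end qBinomial

/-! ### Al-Salam–Chihara polynomials and their generating function. -/

section AlSalamChihara

/-- The Al-Salam–Chihara polynomials `Q_n(x;a,b|q)/(q;q)_n`, through their recurrence relation. -/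
def asc {K : Type*} [Field K] (a b q x : K) : ℕ → K
  | 0 => 1
  | 1 => (2 * x - (a + b)) / (1 - q)
  | n + 2 => ((2 * x - (a + b) * q ^ (n + 1)) * asc a b q x (n + 1) -
      (1 - a * b * q ^ n) * asc a b q x n) / (1 - q ^ (n + 2))

lemma ofReal_asc (a b q x : ℝ) (n : ℕ) :
    ((asc a b q x n : ℝ) : ℂ) = asc (a : ℂ) (b : ℂ) (q : ℂ) (x : ℂ) n := by
  induction n using Nat.twoStepInduction with
  | zero => simp [asc]
  | one => simp [asc]
  | more n h1 h2 => simp [asc, h1, h2]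

lemma continuous_asc (a b q : ℝ) (n : ℕ) : Continuous fun x => asc a b q x n := by
  induction n using Nat.twoStepInduction with
  | zero => exact continuous_const
  | one => simp only [asc]; fun_prop
  | more n h1 h2 => simp only [asc]; fun_prop

variable {K : Type*} [NormedField K]

lemma asc_one {q : K} (hq : ‖q‖ < 1) (a b x : K) :
    (1 - q) * asc a b q x 1 = 2 * x - (a + b) := by
  have : 1 - q ≠ 0 := by simpa using one_sub_pow_succ_ne_zero hq 0
  rw [asc]; field_simp

lemma asc_add_two {q : K} (hq : ‖q‖ < 1) (a b x : K) (n : ℕ) :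
    (1 - q ^ (n + 2)) * asc a b q x (n + 2) =
      (2 * x - (a + b) * q ^ (n + 1)) * asc a b q x (n + 1) -
        (1 - a * b * q ^ n) * asc a b q x n := by
  have := one_sub_pow_succ_ne_zero hq (n + 1)
  rw [asc]; field_simp

/-- Since 1 - q^(n+1) never vanishes, the recurrence determines the sequence. This identifies both
the Cauchy product in `asc_eq_sum` and the hypergeometric sum in `asc_eq_phiSum`. -/
lemma eq_asc {q : K} (hq : ‖q‖ < 1) {a b x : K} {f : ℕ → K} (h0 : f 0 = 1)
    (h1 : (1 - q) * f 1 = 2 * x - (a + b))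
    (h2 : ∀ n, (1 - q ^ (n + 2)) * f (n + 2) =
      (2 * x - (a + b) * q ^ (n + 1)) * f (n + 1) - (1 - a * b * q ^ n) * f n) (n : ℕ) :
    f n = asc a b q x n := by
  induction n using Nat.twoStepInduction with
  | zero => simpa [asc] using h0
  | one =>
    have : 1 - q ≠ 0 := by simpa using one_sub_pow_succ_ne_zero hq 0
    rw [asc, ← h1]; field_simp
  | more n e1 e2 =>
    have := one_sub_pow_succ_ne_zero hq (n + 1)
    rw [asc, ← e1, ← e2, ← h2]; field_simp

open PowerSeries in
-- The functional equation of (bX;q)_∞/(zX;q)_∞ as formal power series, where no convergence is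
-- needed.
lemma qBinomCoeff_mk {q : K} (hq : ‖q‖ < 1) (z b : K) :
    (1 - C z * X) * PowerSeries.mk (qBinomCoeff z b q) =
      (1 - C b * X) * rescale q (PowerSeries.mk (qBinomCoeff z b q)) := by
  ext n
  rcases n with _ | n
  · simp only [sub_mul, one_mul, mul_assoc, map_sub, coeff_C_mul, coeff_zero_X_mul, coeff_rescale,
      pow_zero, mul_zero]
  · have := qBinomCoeff_succ hq z b n
    simp only [sub_mul, one_mul, mul_assoc, map_sub, coeff_C_mul, coeff_succ_X_mul, coeff_mk,
      coeff_rescale]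
    linear_combination this

open PowerSeries in
-- The product G of the two series satisfies (1-zX)(1-wX) G(X) = (1-aX)(1-bX) G(qX). As zw = 1 and z
-- + w = 2x, comparing coefficients gives the recurrence of `asc`.
lemma asc_eq_sum {q : K} (hq : ‖q‖ < 1) {a b x z w : K} (hzw : z * w = 1) (hx : 2 * x = z + w)
    (n : ℕ) : asc a b q x n =
      ∑ k ∈ Finset.range (n + 1), qBinomCoeff z b q k * qBinomCoeff w a q (n - k) := by
  set A := PowerSeries.mk (qBinomCoeff z b q) with hA
  set B := PowerSeries.mk (qBinomCoeff w a q) with hB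
  -- An opaque name for a + b keeps `map_add` from splitting `C (a + b)` when coefficients are
  -- extracted.
  obtain ⟨s, hs⟩ : ∃ s, s = a + b := ⟨_, rfl⟩
  have h : A * B - C (2 * x) * (X * (A * B)) + X * (X * (A * B)) =
      rescale q (A * B) - C s * (X * rescale q (A * B)) +
        C (a * b) * (X * (X * rescale q (A * B))) := by
    have e1 := qBinomCoeff_mk hq z b
    have e2 := qBinomCoeff_mk hq w a
    rw [← hA] at e1
    rw [← hB] at e2
    have e3 : (C z : K⟦X⟧) * C w = 1 := by rw [← map_mul, hzw, map_one]
    rw [hs, hx, map_mul (rescale q), map_add, map_add, map_mul C]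
    linear_combination (1 - C w * X) * B * e1 + (1 - C b * X) * rescale q A * e2 -
      X * X * A * B * e3
  have hc : ∀ n, coeff n (A * B) = asc a b q x n := by
    refine eq_asc hq ?_ ?_ fun n => ?_
    · simp [hA, hB, qBinomCoeff_zero]
    · have h0 : coeff 0 (A * B) = 1 := by simp [hA, hB, qBinomCoeff_zero]
      have := congrArg (coeff (0 + 1)) h
      simp only [map_add, map_sub, coeff_C_mul, coeff_succ_X_mul, coeff_rescale,
        coeff_zero_X_mul, h0] at this
      simp only [zero_add] at this
      linear_combination this - hs
    · have := congrArg (coeff (n + 2)) h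
      simp only [map_add, map_sub, coeff_C_mul, coeff_succ_X_mul, coeff_rescale] at this
      linear_combination this - q ^ (n + 1) * coeff (n + 1) (A * B) * hs
  rw [← hc, coeff_mul, Finset.Nat.sum_antidiagonal_eq_sum_range_succ_mk]
  simp [hA, hB]

/-- The generating function of the Al-Salam–Chihara polynomials. -/
lemma hasSum_asc [CompleteSpace K] {q : K} (hq : ‖q‖ < 1) (a b : K) {x z w t : K}
    (hzw : z * w = 1) (hx : 2 * x = z + w) (hz : ‖z * t‖ < 1) (hw : ‖w * t‖ < 1) :
    HasSum (fun n => asc a b q x n * t ^ n)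
      (qPochInf (a * t) q * qPochInf (b * t) q / (qPochInf (z * t) q * qPochInf (w * t) q)) := by
  have := hasSum_sum_range_mul_of_summable_norm (summable_norm_qBinomCoeff hq z b hz)
    (summable_norm_qBinomCoeff hq w a hw)
  rw [(hasSum_qBinomCoeff hq z b hz).tsum_eq, (hasSum_qBinomCoeff hq w a hw).tsum_eq,
    div_mul_div_comm, mul_comm (qPochInf (b * t) q)] at this
  convert this using 2 with n
  rw [asc_eq_sum hq hzw hx, Finset.sum_mul]
  refine Finset.sum_congr rfl fun k hk => ?_
  have : n = k + (n - k) := by have := Finset.mem_range.1 hk; omega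
  conv_lhs => rw [this, pow_add]
  simp only [← this]
  ring

end AlSalamChihara

/-! ### The ₃φ₂ representation and the q-Laguerre specialization. -/

section Hypergeometric

/-- `(A e^{iθ};q)_k (A e^{-iθ};q)_k` as a polynomial in `y = cos θ`. -/
def qPochPair (a q y : ℝ) (k : ℕ) : ℝ :=
  ∏ j ∈ Finset.range k, (1 - 2 * a * q ^ j * y + (a * q ^ j) ^ 2)

/-- The coefficients of the `₃φ₂` defining the Al-Salam–Chihara polynomials. -/
def phiCoeff (c q : ℝ) (n k : ℕ) : ℝ :=
  qPoch ((q ^ n)⁻¹) q k / (qPoch c q k * qPoch q q k) * q ^ k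

lemma phiCoeff_eq_zero {q : ℝ} (hq : 0 < q) (c : ℝ) {n k : ℕ} (h : n < k) :
    phiCoeff c q n k = 0 := by
  have : qPoch ((q ^ n)⁻¹) q k = 0 := by
    refine Finset.prod_eq_zero (Finset.mem_range.2 h) ?_
    rw [inv_mul_cancel₀ (pow_pos hq n).ne', sub_self]
  simp [phiCoeff, this]

/-- The `₃φ₂` defining the Al-Salam–Chihara polynomials. -/
def phiSum (a c q y : ℝ) (n : ℕ) : ℝ :=
  ∑ k ∈ Finset.range (n + 1), phiCoeff c q n k * qPochPair a q y k

lemma phiSum_eq {q : ℝ} (hq : 0 < q) (a c y : ℝ) {n m : ℕ} (h : n + 1 ≤ m) :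
    phiSum a c q y n = ∑ k ∈ Finset.range m, phiCoeff c q n k * qPochPair a q y k := by
  refine Finset.sum_subset (Finset.range_mono h) fun k _ hk => ?_
  rw [phiCoeff_eq_zero hq c (by simpa using hk), zero_mul]

variable {a b q : ℝ}

/-- Creative telescoping: the recurrence in n fails termwise, but its k-th term is a difference in
k. The right-hand side is the certificate, and it vanishes once m > n + 1. -/
lemma phiSum_telescope (h0 : 0 < q) (h1 : q < 1) (hab : a * b < 1) (y : ℝ) (n m : ℕ) :
    ∑ k ∈ Finset.range (m + 1), ((1 - a * b * q ^ (n + 1)) * phiCoeff (a * b) q (n + 2) k +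
      (a * (a + b) * q ^ (n + 1) - 2 * a * y) * phiCoeff (a * b) q (n + 1) k +
      a ^ 2 * (1 - q ^ (n + 1)) * phiCoeff (a * b) q n k) * qPochPair a q y k =
    (q ^ m)⁻¹ * phiCoeff (a * b) q (n + 1) m * qPochPair a q y (m + 1) := by
  have hqn : q ^ n ≠ 0 := (pow_pos h0 n).ne'
  induction m with
  | zero =>
    simp [phiCoeff, qPochPair, qPoch]
    ring
  | succ m ih =>
    rw [Finset.sum_range_succ, ih]
    have hqm : q ^ m ≠ 0 := (pow_pos h0 m).ne'
    have d1 := (qPoch_pos h0 h1 hab m).ne'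
    have d2 := (qPoch_pos h0 h1 hab (m + 1)).ne'
    have d3 := (qPoch_pos h0 h1 h1 m).ne'
    have d4 := (qPoch_pos h0 h1 h1 (m + 1)).ne'
    -- `e1`, `e2` and `e3` express the three numerators through the common factor (q^(-n-1);q)_m; in
    -- `e3` the coefficient 1 - q^(n+1) is kept so that nothing has to be divided.
    have e1 : qPoch ((q ^ (n + 2))⁻¹) q (m + 1) =
        (1 - (q ^ (n + 2))⁻¹) * qPoch ((q ^ (n + 1))⁻¹) q m := by
      rw [qPoch_succ']; congr 2; field_simp; ring
    have e2 : qPoch ((q ^ (n + 1))⁻¹) q (m + 1) =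
        qPoch ((q ^ (n + 1))⁻¹) q m * (1 - (q ^ (n + 1))⁻¹ * q ^ m) := qPoch_succ _ _ _
    have e3 : (1 - q ^ (n + 1)) * qPoch ((q ^ n)⁻¹) q (m + 1) = - q ^ (n + 1) *
        (qPoch ((q ^ (n + 1))⁻¹) q m * (1 - (q ^ (n + 1))⁻¹ * q ^ m) *
          (1 - (q ^ (n + 1))⁻¹ * q ^ (m + 1))) := by
      rw [← qPoch_succ, ← qPoch_succ, qPoch_succ' ((q ^ (n + 1))⁻¹)]
      have : (q ^ (n + 1))⁻¹ * q = (q ^ n)⁻¹ := by field_simp; ring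
      rw [this]
      field_simp
      ring
    have e4 : a ^ 2 * (1 - q ^ (n + 1)) * phiCoeff (a * b) q n (m + 1) =
        a ^ 2 * (- q ^ (n + 1) * (qPoch ((q ^ (n + 1))⁻¹) q m * (1 - (q ^ (n + 1))⁻¹ * q ^ m) *
          (1 - (q ^ (n + 1))⁻¹ * q ^ (m + 1)))) / (qPoch (a * b) q (m + 1) * qPoch q q (m + 1)) *
            q ^ (m + 1) := by
      rw [phiCoeff, ← e3]; ring
    have e5 : qPochPair a q y (m + 1 + 1) = qPochPair a q y (m + 1) *
        (1 - 2 * a * q ^ (m + 1) * y + (a * q ^ (m + 1)) ^ 2) := Finset.prod_range_succ _ _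
    rw [e4, e5]
    simp only [phiCoeff]
    rw [e1, e2]
    rw [qPoch_succ] at d2 d4
    have d5 := right_ne_zero_of_mul d2
    have d6 := right_ne_zero_of_mul d4
    rw [qPoch_succ (a * b), qPoch_succ q]
    generalize qPoch ((q ^ (n + 1))⁻¹) q m = X
    generalize qPochPair a q y (m + 1) = Y
    generalize qPoch (a * b) q m = U at *
    generalize qPoch q q m = V at *
    simp only [pow_succ, pow_zero, one_mul] at *
    generalize q ^ n = N at *
    generalize q ^ m = M at *
    obtain ⟨D, hD⟩ : ∃ D, D = 1 - a * b * M := ⟨_, rfl⟩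
    obtain ⟨E, hE⟩ : ∃ E, E = 1 - q * M := ⟨_, rfl⟩
    rw [← hD] at d5 ⊢
    rw [← hE] at d6 ⊢
    field_simp
    rw [hD, hE]
    ring

lemma phiSum_rec (h0 : 0 < q) (h1 : q < 1) (hab : a * b < 1) (y : ℝ) (n : ℕ) :
    (1 - a * b * q ^ (n + 1)) * phiSum a (a * b) q y (n + 2) +
      (a * (a + b) * q ^ (n + 1) - 2 * a * y) * phiSum a (a * b) q y (n + 1) +
      a ^ 2 * (1 - q ^ (n + 1)) * phiSum a (a * b) q y n = 0 := by
  have := phiSum_telescope h0 h1 hab y n (n + 2)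
  rw [phiCoeff_eq_zero h0 _ (by omega : n + 1 < n + 2)] at this
  rw [phiSum_eq h0 a _ y (by omega : n + 2 + 1 ≤ n + 2 + 1),
    phiSum_eq h0 a _ y (by omega : n + 1 + 1 ≤ n + 2 + 1),
    phiSum_eq h0 a _ y (by omega : n + 1 ≤ n + 2 + 1), Finset.mul_sum, Finset.mul_sum,
    Finset.mul_sum, ← Finset.sum_add_distrib, ← Finset.sum_add_distrib]
  simp only [mul_zero, zero_mul] at this
  rw [← this]
  exact Finset.sum_congr rfl fun k _ => by ring

/-- After division by a^n, `phiSum_rec` is the recurrence of `asc`, with the same first two values.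
-/
lemma asc_eq_phiSum (h0 : 0 < q) (h1 : q < 1) (ha : a ≠ 0) (hab : a * b < 1) (y : ℝ) (n : ℕ) :
    qPoch (a * b) q n / qPoch q q n * phiSum a (a * b) q y n = a ^ n * asc a b q y n := by
  have hq : ‖q‖ < 1 := by rwa [Real.norm_of_nonneg h0.le]
  have hq1 : 1 - q ≠ 0 := by linarith
  have key := eq_asc (K := ℝ) hq (a := a) (b := b) (x := y)
    (f := fun n => (a ^ n)⁻¹ * (qPoch (a * b) q n / qPoch q q n * phiSum a (a * b) q y n))
    ?_ ?_ (fun n => ?_) n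
  · rw [← key]; field_simp
  · simp [phiSum, phiCoeff, qPochPair, qPoch]
  · simp [phiSum, phiCoeff, qPochPair, qPoch, Finset.sum_range_succ]
    have : 1 - a * b ≠ 0 := by linarith
    field_simp
    ring
  · have hrec := phiSum_rec h0 h1 hab y n
    have d1 := (qPoch_pos h0 h1 hab n).ne'
    have d3 := (qPoch_pos h0 h1 h1 n).ne'
    have d4 := (qPoch_pos h0 h1 h1 (n + 1)).ne'
    have d6 := (qPoch_pos h0 h1 h1 (n + 2)).ne'
    simp only [qPoch_succ _ _ (n + 1), qPoch_succ _ _ n] at d4 d6 ⊢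
    have d7 := right_ne_zero_of_mul d4
    have d8 := right_ne_zero_of_mul d6
    have hh : (1 - q ^ (n + 2)) = 1 - q * q ^ (n + 1) := by ring
    rw [hh]
    have hX : (1 - a * b * q ^ (n + 1)) * phiSum a (a * b) q y (n + 2) =
      -((a * (a + b) * q ^ (n + 1) - 2 * a * y) * phiSum a (a * b) q y (n + 1) +
      a ^ 2 * (1 - q ^ (n + 1)) * phiSum a (a * b) q y n) := by linear_combination hrec
    have : (1 - q * q ^ (n + 1)) * ((a ^ (n + 2))⁻¹ * (qPoch (a * b) q n * (1 - a * b * q ^ n) *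
        (1 - a * b * q ^ (n + 1)) / (qPoch q q n * (1 - q * q ^ n) * (1 - q * q ^ (n + 1))) *
          phiSum a (a * b) q y (n + 2))) = (1 - q * q ^ (n + 1)) * ((a ^ (n + 2))⁻¹ *
        (qPoch (a * b) q n * (1 - a * b * q ^ n) /
          (qPoch q q n * (1 - q * q ^ n) * (1 - q * q ^ (n + 1))) *
          ((1 - a * b * q ^ (n + 1)) * phiSum a (a * b) q y (n + 2)))) := by ring
    rw [this, hX]
    simp only [pow_succ, pow_zero, one_mul] at *
    obtain ⟨D, hD⟩ : ∃ D, D = 1 - q * q ^ n := ⟨_, rfl⟩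
    obtain ⟨E, hE⟩ : ∃ E, E = 1 - q * (q ^ n * q) := ⟨_, rfl⟩
    rw [← hD] at d7 ⊢
    rw [← hE] at d8 ⊢
    field_simp
    rw [hD]
    ring

/-- For α = 2l - 1 one has α/2 + 1/4 = l - 1/4 and q^(α+1) = q^(l-1/4) q^(l+1/4), which are the a
and ab of the ₃φ₂. -/
lemma P_eq_asc (h0 : 0 < q) (h1 : q < 1) {l : ℝ} (hl : 0 < l) (y : ℝ) (n : ℕ) :
    P q (2 * l - 1) n y =
      (q ^ (l - 1 / 4)) ^ n * asc (q ^ (l - 1 / 4)) (q ^ (l + 1 / 4)) q y n := by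
  have e : q ^ (l - 1 / 4) * q ^ (l + 1 / 4) = q ^ (2 * l) := by
    rw [← Real.rpow_add h0]; ring_nf
  rw [← asc_eq_phiSum h0 h1 (Real.rpow_pos_of_pos h0 _).ne'
    (by rw [e]; exact Real.rpow_lt_one h0.le h1 (by linarith)), e, P, phiSum]
  have e1 : 2 * l - 1 + 1 = 2 * l := by ring
  have e2 : (2 * l - 1) / 2 + 1 / 4 = l - 1 / 4 := by ring
  rw [e1, e2]
  congr 1
  refine Finset.sum_congr rfl fun k _ => ?_
  rw [phiCoeff, qPochPair]
  ring

end Hypergeometric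

/-! ### The finite Jacobi triple product and limits of its coefficients. -/

section TripleProduct

variable {K : Type*} [NormedField K] {q : K}

lemma qBinomCoeff_eq_zero (M : ℕ) {k : ℕ} (h : M < k) : qBinomCoeff (q ^ M) 1 q k = 0 :=
  Finset.prod_eq_zero (Finset.mem_range.2 h) (by simp)

/-- For z = q^M and b = 1 the coefficients are Gaussian binomials times (-1)^i q^(i(i-1)/2), here
with denominators cleared. -/
lemma qBinomCoeff_eq (hq : ‖q‖ < 1) (M i : ℕ) (h : i ≤ M) :
    qBinomCoeff (q ^ M) 1 q i * (qPoch q q i * qPoch q q (M - i)) =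
      qPoch q q M * ∏ j ∈ Finset.range i, -q ^ j := by
  induction i with
  | zero => simp [qBinomCoeff_zero, qPoch]
  | succ i ih =>
    obtain ⟨r, rfl⟩ := Nat.exists_eq_add_of_le h
    have e : i + 1 + r - i = r + 1 := by omega
    have hB := qBinomCoeff_succ hq (q ^ (i + 1 + r)) 1 i
    have ih := ih (by omega)
    rw [e, qPoch_succ] at ih
    rw [add_tsub_cancel_left, qPoch_succ, Finset.prod_range_succ]
    linear_combination qPoch q q i * qPoch q q r * hB - q ^ i * ih

/-- The coefficient of `u^(k-N)` in `(u;q)_N (q/u;q)_N`. -/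
def tripleCoeff (q : K) (N k : ℕ) : K :=
  (∏ j ∈ Finset.range N, -q ^ (j + 1)) * qBinomCoeff (q ^ (2 * N)) 1 q k * ((q ^ N)⁻¹) ^ k

lemma tripleCoeff_succ (hq : ‖q‖ < 1) (hq0 : q ≠ 0) (N k : ℕ) :
    (1 - q ^ (k + 1)) * tripleCoeff q N (k + 1) * q ^ N =
      (q ^ (2 * N) - q ^ k) * tripleCoeff q N k := by
  have := qBinomCoeff_succ hq (q ^ (2 * N)) 1 k
  have h : q ^ N ≠ 0 := pow_ne_zero _ hq0
  have e : (q ^ N)⁻¹ * q ^ N = 1 := inv_mul_cancel₀ h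
  simp only [tripleCoeff, pow_succ ((q ^ N)⁻¹)]
  linear_combination (∏ j ∈ Finset.range N, -q ^ (j + 1)) * ((q ^ N)⁻¹) ^ k * this +
    (1 - q ^ (k + 1)) * (∏ j ∈ Finset.range N, -q ^ (j + 1)) *
      qBinomCoeff (q ^ (2 * N)) 1 q (k + 1) * ((q ^ N)⁻¹) ^ k * e

lemma tripleCoeff_self (hq : ‖q‖ < 1) (hq0 : q ≠ 0) (N : ℕ) :
    tripleCoeff q N N = qPoch q q (2 * N) / (qPoch q q N * qPoch q q N) := by
  have h1 := qBinomCoeff_eq hq (2 * N) N (by omega)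
  have e : 2 * N - N = N := by omega
  rw [e] at h1
  -- Reversing the first product pairs -q^(N-j) with -q^j, so each of the N pairs contributes q^N.
  have h2 : (∏ j ∈ Finset.range N, -q ^ (j + 1)) * (∏ j ∈ Finset.range N, -q ^ j) *
      ((q ^ N)⁻¹) ^ N = 1 := by
    rw [← Finset.prod_range_reflect, ← Finset.prod_mul_distrib]
    rw [show ((q ^ N)⁻¹) ^ N = ∏ j ∈ Finset.range N, (q ^ N)⁻¹ by simp,
      ← Finset.prod_mul_distrib]
    refine Finset.prod_eq_one fun j hj => ?_
    have : N = N - 1 - j + 1 + j := by have := Finset.mem_range.1 hj; omega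
    rw [neg_mul_neg, ← pow_add, ← this, mul_inv_cancel₀ (pow_ne_zero _ hq0)]
  have h3 := qPoch_ne_zero hq hq N
  rw [eq_div_iff (mul_ne_zero h3 h3), tripleCoeff]
  linear_combination (∏ j ∈ Finset.range N, -q ^ (j + 1)) * ((q ^ N)⁻¹) ^ N * h1 +
    qPoch q q (2 * N) * h2

/-- By `tripleCoeff_succ` the ratio of consecutive coefficients tends to -q^i/q^m, so one limit
determines those at all higher indices. The coefficient in question belongs to u^(i-m). -/
lemma tendsto_tripleCoeff_add (hq : ‖q‖ < 1) (hq0 : q ≠ 0) {m : ℕ} {L : K}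
    (h : Tendsto (fun N => tripleCoeff q (N + m) N) atTop (𝓝 L)) (i : ℕ) :
    Tendsto (fun N => tripleCoeff q (N + m) (N + i)) atTop
      (𝓝 (L * ((∏ j ∈ Finset.range i, -q ^ j) * ((q ^ m)⁻¹) ^ i))) := by
  induction i with
  | zero => simpa using h
  | succ i ih =>
    have hp := tendsto_pow_atTop_nhds_zero_of_norm_lt_one hq
    have h1 : Tendsto (fun N : ℕ => (q ^ N * q ^ m * q ^ m - q ^ i) / q ^ m / (1 - q ^ (N + (i + 1))))
        atTop (𝓝 ((0 * q ^ m * q ^ m - q ^ i) / q ^ m / (1 - 0))) :=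
      ((((hp.mul_const _).mul_const _).sub_const _).div_const _).div
        ((hp.comp (tendsto_add_atTop_nat (i + 1))).const_sub 1) (by simp)
    have h2 := h1.mul ih
    have e : (0 * q ^ m * q ^ m - q ^ i) / q ^ m / (1 - 0) * (L * ((∏ j ∈ Finset.range i, -q ^ j) *
        ((q ^ m)⁻¹) ^ i)) = L * ((∏ j ∈ Finset.range (i + 1), -q ^ j) * ((q ^ m)⁻¹) ^ (i + 1)) := by
      rw [Finset.prod_range_succ, pow_succ ((q ^ m)⁻¹)]
      ring
    rw [e] at h2
    refine h2.congr fun N => ?_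
    have e1 := tripleCoeff_succ hq hq0 (N + m) (N + i)
    have e2 := one_sub_pow_succ_ne_zero hq (N + i)
    have e3 : q ^ N ≠ 0 := pow_ne_zero _ hq0
    have e4 : q ^ m ≠ 0 := pow_ne_zero _ hq0
    rw [← add_assoc, div_div, div_mul_eq_mul_div, div_eq_iff (mul_ne_zero e4 e2)]
    refine mul_right_cancel₀ e3 ?_
    linear_combination -e1

variable [CompleteSpace K]

/-- The q-binomial theorem with z = q^M, b = 1: the series terminates and (t;q)_∞/(q^M t;q)_∞ =
(t;q)_M. The bound on t is inherited from the convergence of the infinite series. -/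
lemma sum_qBinomCoeff (hq : ‖q‖ < 1) (M : ℕ) {t : K} (ht : ‖q ^ M * t‖ < 1) :
    ∑ k ∈ Finset.range (M + 1), qBinomCoeff (q ^ M) 1 q k * t ^ k = qPoch t q M := by
  have h := hasSum_qBinomCoeff hq (q ^ M) 1 ht
  rw [one_mul, qPochInf_eq_qPoch_mul hq t M, mul_comm t, mul_div_assoc,
    div_self (qPochInf_ne_zero hq ht), mul_one] at h
  refine (hasSum_sum_of_ne_finset_zero fun k hk => ?_).unique h
  rw [qBinomCoeff_eq_zero M (by simpa using hk), zero_mul]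

/-- The finite Jacobi triple product. -/
lemma sum_tripleCoeff (hq : ‖q‖ < 1) (hq0 : q ≠ 0) {u : K} (hu : ‖u‖ = 1) {N : ℕ} (hN : N ≠ 0) :
    qPoch u q N * qPoch (u⁻¹ * q) q N =
      ∑ k ∈ Finset.range (2 * N + 1), tripleCoeff q N k * (u ^ k * (u ^ N)⁻¹) := by
  have hu0 : u ≠ 0 := norm_ne_zero_iff.1 (by rw [hu]; exact one_ne_zero)
  have hqN : q ^ N ≠ 0 := pow_ne_zero _ hq0
  -- The argument uq^(-N) centres the 2N factors around u; the norm condition becomes ‖q‖^N < 1,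
  -- whence N ≠ 0.
  have h := sum_qBinomCoeff hq (2 * N) (t := u * (q ^ N)⁻¹) (by
    rw [two_mul, pow_add, mul_comm u, mul_assoc, ← mul_assoc (q ^ N) ((q ^ N)⁻¹),
      mul_inv_cancel₀ hqN, one_mul, norm_mul, hu, mul_one, norm_pow]
    exact pow_lt_one₀ (norm_nonneg q) hq hN)
  have e1 : qPoch (u * (q ^ N)⁻¹) q (2 * N) = qPoch (u * (q ^ N)⁻¹) q N * qPoch u q N := by
    rw [two_mul, qPoch_add]; congr 2; field_simp
  -- The factors with negative powers of q, read backwards: -q^(j+1)(1 - uq^(-j-1)) = u(1 -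
  -- q^(j+1)/u).
  have e2 : (∏ j ∈ Finset.range N, -q ^ (j + 1)) * qPoch (u * (q ^ N)⁻¹) q N =
      u ^ N * qPoch (u⁻¹ * q) q N := by
    rw [qPoch, ← Finset.prod_range_reflect (fun j => 1 - u * (q ^ N)⁻¹ * q ^ j),
      ← Finset.prod_mul_distrib, qPoch,
      show u ^ N = ∏ j ∈ Finset.range N, u by simp, ← Finset.prod_mul_distrib]
    refine Finset.prod_congr rfl fun j hj => ?_
    have : N = N - 1 - j + (j + 1) := by have := Finset.mem_range.1 hj; omega
    have e3 : q ^ N = q ^ (N - 1 - j) * q ^ (j + 1) := by rw [← pow_add, ← this]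
    have h4 : q ^ (N - 1 - j) ≠ 0 := pow_ne_zero _ hq0
    rw [e3]
    field_simp
    ring
  have e3 : qPoch u q N * qPoch (u⁻¹ * q) q N = (u ^ N)⁻¹ *
      ((∏ j ∈ Finset.range N, -q ^ (j + 1)) * (qPoch (u * (q ^ N)⁻¹) q N * qPoch u q N)) := by
    rw [← mul_assoc (∏ j ∈ _, _), e2]; field_simp
  rw [e3, ← e1, ← h, Finset.mul_sum, Finset.mul_sum]
  refine Finset.sum_congr rfl fun k _ => ?_
  rw [tripleCoeff, mul_pow]
  ring

lemma tendsto_tripleCoeff_self (hq : ‖q‖ < 1) (hq0 : q ≠ 0) :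
    Tendsto (fun N => tripleCoeff q N N) atTop (𝓝 (qPochInf q q)⁻¹) := by
  have h0 := qPochInf_ne_zero hq hq
  have h := tendsto_qPoch hq q
  have := (h.comp (tendsto_id.const_mul_atTop' two_pos)).div (h.mul h) (mul_ne_zero h0 h0)
  rw [show qPochInf q q / (qPochInf q q * qPochInf q q) = (qPochInf q q)⁻¹ by field_simp] at this
  exact this.congr fun N => (tripleCoeff_self hq hq0 N).symm

/-- The value of the limit is not needed: for m ≠ 0 it will multiply a sum that vanishes. -/
lemma exists_tendsto_tripleCoeff (hq : ‖q‖ < 1) (hq0 : q ≠ 0) (m : ℕ) :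
    ∃ L, Tendsto (fun N => tripleCoeff q (N + m) N) atTop (𝓝 L) := by
  induction m with
  | zero => exact ⟨_, tendsto_tripleCoeff_self hq hq0⟩
  | succ m ih =>
    obtain ⟨L, hL⟩ := ih
    have hp := tendsto_pow_atTop_nhds_zero_of_norm_lt_one hq
    have h1 : Tendsto (fun N : ℕ => (1 - q ^ (N + 1)) * q ^ (m + 1) / (q ^ (N + 2 * (m + 1)) - 1))
        atTop (𝓝 ((1 - 0) * q ^ (m + 1) / (0 - 1))) :=
      (((hp.comp (tendsto_add_atTop_nat 1)).const_sub 1).mul_const _).div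
        ((hp.comp (tendsto_add_atTop_nat (2 * (m + 1)))).sub_const 1) (by simp)
    refine ⟨_, (h1.mul (hL.comp (tendsto_add_atTop_nat 1))).congr fun N => ?_⟩
    have e1 := tripleCoeff_succ hq hq0 (N + (m + 1)) N
    have e2 : q ^ (N + 2 * (m + 1)) - 1 ≠ 0 := by
      rw [← neg_sub]; exact neg_ne_zero.2 (one_sub_pow_succ_ne_zero hq (N + 2 * m + 1))
    have e3 : q ^ N ≠ 0 := pow_ne_zero _ hq0
    have e4 : N + 1 + m = N + (m + 1) := by ring
    simp only [Function.comp, e4]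
    rw [div_mul_eq_mul_div, div_eq_iff e2]
    refine mul_right_cancel₀ e3 ?_
    linear_combination e1

end TripleProduct

/-! ### Moments of the continuous q-Hermite weight. -/

section HermiteWeight

/-- `e^{iθ}`. -/
def circ (θ : ℝ) : ℂ := Complex.exp (θ * Complex.I)

lemma circ_ne_zero (θ : ℝ) : circ θ ≠ 0 := Complex.exp_ne_zero _

lemma norm_circ (θ : ℝ) : ‖circ θ‖ = 1 := Complex.norm_exp_ofReal_mul_I θ

lemma continuous_circ : Continuous circ := by unfold circ; fun_prop

lemma conj_circ (θ : ℝ) : starRingEnd ℂ (circ θ) = (circ θ)⁻¹ := by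
  rw [circ, ← Complex.exp_conj, ← Complex.exp_neg]; simp

lemma circ_neg (θ : ℝ) : circ (-θ) = (circ θ)⁻¹ := by
  rw [circ, circ, ← Complex.exp_neg]; simp

lemma two_cos_eq (θ : ℝ) : 2 * ((Real.cos θ : ℝ) : ℂ) = circ θ + (circ θ)⁻¹ := by
  rw [circ, ← Complex.exp_neg, Complex.ofReal_cos, Complex.cos]
  ring_nf

lemma integral_circ_zpow (n : ℤ) :
    ∫ θ in -Real.pi..Real.pi, circ θ ^ n = if n = 0 then 2 * (Real.pi : ℂ) else 0 := by
  split_ifs with h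
  · simp [h]; ring
  · have hn : (n : ℂ) * Complex.I ≠ 0 := mul_ne_zero (by exact_mod_cast h) Complex.I_ne_zero
    have e : ∀ θ : ℝ, circ θ ^ n = Complex.exp (n * Complex.I * θ) := fun θ => by
      rw [circ, ← Complex.exp_int_mul]; ring_nf
    simp only [e]
    rw [integral_exp_mul_complex hn]
    have : Complex.exp (n * Complex.I * (Real.pi : ℝ)) =
        Complex.exp (n * Complex.I * ((-Real.pi : ℝ) : ℂ)) := by
      rw [Complex.exp_eq_exp_iff_exists_int]
      exact ⟨n, by push_cast; ring⟩
    rw [this, sub_self, zero_div]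

variable {q : ℝ}

/-- The weight `|(e^{2iθ};q)_∞|²` of the continuous `q`-Hermite polynomials. -/
def hermiteWeight (q θ : ℝ) : ℝ := ‖qPochInf (circ θ ^ 2) (q : ℂ)‖ ^ 2

lemma norm_ofReal_lt_one (h0 : 0 < q) (h1 : q < 1) : ‖(q : ℂ)‖ < 1 := by
  rwa [Complex.norm_real, Real.norm_of_nonneg h0.le]

lemma ofReal_norm_qPochInf_sq (h0 : 0 < q) (h1 : q < 1) (a : ℂ) :
    ((‖qPochInf a (q : ℂ)‖ ^ 2 : ℝ) : ℂ) =
      qPochInf a (q : ℂ) * qPochInf (starRingEnd ℂ a) (q : ℂ) := by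
  rw [← conj_qPochInf h0 h1, Complex.mul_conj, Complex.normSq_eq_norm_sq]

lemma continuous_hermiteWeight (h0 : 0 < q) (h1 : q < 1) : Continuous (hermiteWeight q) :=
  ((continuous_qPochInf (norm_ofReal_lt_one h0 h1)).comp (continuous_circ.pow 2)).norm.pow 2

/-- From 1 + x ≤ e^x and the geometric series; being uniform in n, it serves as the dominating
constant. -/
lemma norm_qPoch_le (h0 : 0 < q) (h1 : q < 1) {a : ℂ} (ha : ‖a‖ ≤ 1) (n : ℕ) :
    ‖qPoch a (q : ℂ) n‖ ≤ Real.exp (1 - q)⁻¹ := by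
  rw [qPoch, norm_prod]
  calc _ ≤ ∏ j ∈ Finset.range n, Real.exp (q ^ j) := by
        refine Finset.prod_le_prod (fun _ _ => norm_nonneg _) fun j _ => ?_
        have h2 : ‖a * (q : ℂ) ^ j‖ ≤ q ^ j := by
          rw [norm_mul, norm_pow, Complex.norm_real, Real.norm_of_nonneg h0.le]
          exact mul_le_of_le_one_left (pow_nonneg h0.le j) ha
        have := norm_sub_le (1 : ℂ) (a * (q : ℂ) ^ j)
        rw [norm_one] at this
        linarith [Real.add_one_le_exp (q ^ j)]
    _ = Real.exp (∑ j ∈ Finset.range n, q ^ j) := (Real.exp_sum _ _).symm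
    _ ≤ _ := by
        rw [Real.exp_le_exp, ← tsum_geometric_of_lt_one h0.le h1]
        exact (summable_geometric_of_lt_one h0.le h1).sum_le_tsum _
          fun _ _ => pow_nonneg h0.le _

/-- A finite product approximating `hermiteWeight`. -/
def finiteWeight (q : ℝ) (N : ℕ) (θ : ℝ) : ℂ :=
  qPoch (circ θ ^ 2) (q : ℂ) N * qPoch ((circ θ ^ 2)⁻¹) (q : ℂ) (N + 1)

lemma tendsto_integral_finiteWeight (h0 : 0 < q) (h1 : q < 1) {f : ℝ → ℂ} (hf : Continuous f) :
    Tendsto (fun N => ∫ θ in -Real.pi..Real.pi, f θ * finiteWeight q N θ) atTop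
      (𝓝 (∫ θ in -Real.pi..Real.pi, f θ * (hermiteWeight q θ : ℂ))) := by
  have hq := norm_ofReal_lt_one h0 h1
  have hc : ∀ N, Continuous (finiteWeight q N) := fun N => by
    unfold finiteWeight qPoch
    have h2 : Continuous fun θ => (circ θ ^ 2)⁻¹ :=
      (continuous_circ.pow 2).inv₀ fun θ => pow_ne_zero _ (circ_ne_zero θ)
    have h3 := continuous_circ
    fun_prop
  have hn : ∀ θ, ‖circ θ ^ 2‖ = 1 := fun θ => by rw [norm_pow, norm_circ, one_pow]
  refine intervalIntegral.tendsto_integral_filter_of_dominated_convergence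
    (fun θ => ‖f θ‖ * (Real.exp (1 - q)⁻¹ * Real.exp (1 - q)⁻¹))
    (Eventually.of_forall fun N => (hf.mul (hc N)).aestronglyMeasurable)
    (Eventually.of_forall fun N => Eventually.of_forall fun θ _ => ?_)
    ((hf.norm.mul continuous_const).intervalIntegrable _ _)
    (Eventually.of_forall fun θ _ => ?_)
  · rw [norm_mul, finiteWeight, norm_mul]
    have e1 := norm_qPoch_le h0 h1 (hn θ).le N
    have e2 := norm_qPoch_le h0 h1 (a := (circ θ ^ 2)⁻¹) (by rw [norm_inv, hn, inv_one]) (N + 1)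
    gcongr
  · refine Tendsto.const_mul _ ?_
    rw [hermiteWeight, ofReal_norm_qPochInf_sq h0 h1, map_pow, conj_circ, inv_pow]
    exact (tendsto_qPoch hq _).mul ((tendsto_qPoch hq _).comp (tendsto_add_atTop_nat 1))

lemma integral_circ_zpow_mul_finiteWeight (h0 : 0 < q) (h1 : q < 1) (n : ℤ) {N : ℕ} (hN : N ≠ 0) :
    ∫ θ in -Real.pi..Real.pi, circ θ ^ n * finiteWeight q N θ =
      ∑ k ∈ Finset.range (2 * N + 1), tripleCoeff (q : ℂ) N k *
        ((if n + 2 * k - 2 * N = 0 then 2 * (Real.pi : ℂ) else 0) -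
          if n + 2 * k - 2 * N - 2 = 0 then 2 * (Real.pi : ℂ) else 0) := by
  have hq := norm_ofReal_lt_one h0 h1
  have hq0 : (q : ℂ) ≠ 0 := by exact_mod_cast h0.ne'
  have e : ∀ θ, circ θ ^ n * finiteWeight q N θ = ∑ k ∈ Finset.range (2 * N + 1),
      tripleCoeff (q : ℂ) N k * (circ θ ^ (n + 2 * k - 2 * N) - circ θ ^ (n + 2 * k - 2 * N - 2)) := by
    intro θ
    have hz := circ_ne_zero θ
    -- With u = e^{2iθ}, the extra factor of the (N+1)-fold product is 1 - 1/u, and what remains is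
    -- the triple product (u;q)_N (q/u;q)_N. The factor 1 - 1/u is the source of the difference of
    -- two frequencies.
    rw [finiteWeight, qPoch_succ']
    have := sum_tripleCoeff hq hq0 (u := circ θ ^ 2) (by rw [norm_pow, norm_circ, one_pow]) hN
    rw [show circ θ ^ n * (qPoch (circ θ ^ 2) (q : ℂ) N * ((1 - (circ θ ^ 2)⁻¹) *
      qPoch ((circ θ ^ 2)⁻¹ * q) q N)) = circ θ ^ n * (1 - (circ θ ^ 2)⁻¹) *
      (qPoch (circ θ ^ 2) (q : ℂ) N * qPoch ((circ θ ^ 2)⁻¹ * q) q N) by ring, this,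
      Finset.mul_sum]
    refine Finset.sum_congr rfl fun k _ => ?_
    have a1 : circ θ ^ (2 * (k : ℤ)) = (circ θ ^ 2) ^ k := by
      rw [zpow_mul, zpow_natCast]; rfl
    have a2 : circ θ ^ (2 * (N : ℤ)) = (circ θ ^ 2) ^ N := by
      rw [zpow_mul, zpow_natCast]; rfl
    have a3 : circ θ ^ (2 : ℤ) = circ θ ^ 2 := rfl
    rw [zpow_sub₀ hz _ 2, a3, zpow_sub₀ hz, zpow_add₀ hz, a1, a2]
    field_simp
  have hc : ∀ j : ℤ, Continuous fun θ => circ θ ^ j := fun j =>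
    continuous_circ.zpow₀ j fun θ => Or.inl (circ_ne_zero θ)
  simp only [e]
  rw [intervalIntegral.integral_finsetSum]
  swap
  · intro k _
    exact (continuous_const.mul ((hc _).sub (hc _))).intervalIntegrable _ _
  refine Finset.sum_congr rfl fun k _ => ?_
  rw [intervalIntegral.integral_const_mul, intervalIntegral.integral_sub
    ((hc _).intervalIntegrable _ _) ((hc _).intervalIntegrable _ _), integral_circ_zpow,
    integral_circ_zpow]

lemma qBinomCoeff_inv_circ (θ : ℝ) (n k : ℕ) (hk : k ≤ n) :
    qBinomCoeff (circ θ)⁻¹ 0 (q : ℂ) k * qBinomCoeff (circ θ) 0 (q : ℂ) (n - k) =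
      (qPoch (q : ℂ) q k * qPoch (q : ℂ) q (n - k))⁻¹ * circ θ ^ ((n : ℤ) - 2 * k) := by
  have e : ∀ (z : ℂ) (j : ℕ), qBinomCoeff z 0 (q : ℂ) j = z ^ j * (qPoch (q : ℂ) q j)⁻¹ := by
    intro z j
    simp only [qBinomCoeff, zero_mul, sub_zero]
    rw [Finset.prod_div_distrib, Finset.prod_const, Finset.card_range, div_eq_mul_inv, qPoch]
    simp only [pow_succ']
  have hz := circ_ne_zero θ
  obtain ⟨r, rfl⟩ := Nat.exists_eq_add_of_le hk
  have : ((k + r : ℕ) : ℤ) - 2 * k = r - k := by push_cast; ring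
  rw [e, e, this, zpow_sub₀ hz, zpow_natCast, zpow_natCast, add_tsub_cancel_left, mul_inv, inv_pow]
  ring

lemma continuous_asc_cos (a b q : ℝ) (n : ℕ) : Continuous fun θ => asc a b q (Real.cos θ) n :=
  (continuous_asc a b q n).comp Real.continuous_cos

lemma asc_hermite_eq (h0 : 0 < q) (h1 : q < 1) (n : ℕ) (θ : ℝ) :
    ((asc 0 0 q (Real.cos θ) n : ℝ) : ℂ) = ∑ k ∈ Finset.range (n + 1),
      (qPoch (q : ℂ) q k * qPoch (q : ℂ) q (n - k))⁻¹ * circ θ ^ ((n : ℤ) - 2 * k) := by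
  rw [ofReal_asc, Complex.ofReal_zero, asc_eq_sum (norm_ofReal_lt_one h0 h1)
    (inv_mul_cancel₀ (circ_ne_zero θ)) ((two_cos_eq θ).trans (add_comm _ _))]
  refine Finset.sum_congr rfl fun k hk => ?_
  exact qBinomCoeff_inv_circ θ n k (by have := Finset.mem_range.1 hk; omega)

lemma integral_asc_mul_finiteWeight (h0 : 0 < q) (h1 : q < 1) (n : ℕ) {N : ℕ} (hN : N ≠ 0) :
    ∫ θ in -Real.pi..Real.pi, ((asc 0 0 q (Real.cos θ) n : ℝ) : ℂ) * finiteWeight q N θ =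
      ∑ i ∈ Finset.range (n + 1), (qPoch (q : ℂ) q i * qPoch (q : ℂ) q (n - i))⁻¹ *
        ∑ k ∈ Finset.range (2 * N + 1), tripleCoeff (q : ℂ) N k *
        ((if (n : ℤ) - 2 * i + 2 * k - 2 * N = 0 then 2 * (Real.pi : ℂ) else 0) -
          if (n : ℤ) - 2 * i + 2 * k - 2 * N - 2 = 0 then 2 * (Real.pi : ℂ) else 0) := by
  have hc : ∀ j : ℤ, Continuous fun θ => circ θ ^ j := fun j =>
    continuous_circ.zpow₀ j fun θ => Or.inl (circ_ne_zero θ)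
  have hw : Continuous (finiteWeight q N) := by
    unfold finiteWeight qPoch
    have h2 : Continuous fun θ => (circ θ ^ 2)⁻¹ :=
      (continuous_circ.pow 2).inv₀ fun θ => pow_ne_zero _ (circ_ne_zero θ)
    have h3 := continuous_circ
    fun_prop
  simp only [asc_hermite_eq h0 h1, Finset.sum_mul, mul_assoc]
  rw [intervalIntegral.integral_finsetSum]
  swap
  · intro k _
    exact (continuous_const.mul ((hc _).mul hw)).intervalIntegrable _ _
  refine Finset.sum_congr rfl fun k _ => ?_
  rw [intervalIntegral.integral_const_mul, integral_circ_zpow_mul_finiteWeight h0 h1 _ hN]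

/-- Truncating at N + m makes N + i and N + i + 1 the only resonant indices, the form in which
`tendsto_tripleCoeff_add` gives the limits. -/
lemma integral_asc_even_mul_finiteWeight (h0 : 0 < q) (h1 : q < 1) (m : ℕ) {N : ℕ} (hN : N ≠ 0) :
    ∫ θ in -Real.pi..Real.pi, ((asc 0 0 q (Real.cos θ) (2 * m) : ℝ) : ℂ) *
        finiteWeight q (N + m) θ =
      2 * (Real.pi : ℂ) * ∑ i ∈ Finset.range (2 * m + 1),
        (qPoch (q : ℂ) q i * qPoch (q : ℂ) q (2 * m - i))⁻¹ *
        (tripleCoeff (q : ℂ) (N + m) (N + i) - tripleCoeff (q : ℂ) (N + m) (N + (i + 1))) := by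
  rw [integral_asc_mul_finiteWeight h0 h1 _ (by omega), Finset.mul_sum]
  refine Finset.sum_congr rfl fun i hi => ?_
  have hi := Finset.mem_range.1 hi
  rw [mul_left_comm]
  congr 1
  simp only [mul_sub, Finset.sum_sub_distrib, mul_ite, mul_zero]
  congr 1
  · rw [Finset.sum_eq_single (N + i)]
    · rw [if_pos (by push_cast; ring)]; ring
    · intro k _ hk
      rw [if_neg]
      push_cast; omega
    · intro h
      exact absurd (Finset.mem_range.2 (by omega)) h
  · rw [Finset.sum_eq_single (N + (i + 1))]
    · rw [if_pos (by push_cast; ring)]; ring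
    · intro k _ hk
      rw [if_neg]
      push_cast; omega
    · intro h
      exact absurd (Finset.mem_range.2 (by omega)) h

/-- The sum splits into two terminating q-binomial sums, at q^(-m) and q^(1-m). Both (q^(-m);q)_(2m)
and (q^(1-m);q)_(2m) contain a zero factor when m ≥ 1. -/
lemma sum_hermite_moment_eq_zero {K : Type*} [NormedField K] [CompleteSpace K] {q : K}
    (hq : ‖q‖ < 1) (hq0 : q ≠ 0) {m : ℕ} (hm : m ≠ 0) :
    ∑ i ∈ Finset.range (2 * m + 1), (qPoch q q i * qPoch q q (2 * m - i))⁻¹ *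
      ((∏ j ∈ Finset.range i, -q ^ j) * ((q ^ m)⁻¹) ^ i -
        (∏ j ∈ Finset.range (i + 1), -q ^ j) * ((q ^ m)⁻¹) ^ (i + 1)) = 0 := by
  have hqm : q ^ m ≠ 0 := pow_ne_zero _ hq0
  have hlt : ∀ k, k ≠ 0 → ‖q ^ k‖ < 1 := fun k hk => by
    rw [norm_pow]; exact pow_lt_one₀ (norm_nonneg q) hq hk
  have e1 : qPoch (q ^ m)⁻¹ q (2 * m) = 0 :=
    Finset.prod_eq_zero (Finset.mem_range.2 (by omega : m < 2 * m)) (by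
      rw [inv_mul_cancel₀ hqm, sub_self])
  have e2 : qPoch ((q ^ m)⁻¹ * q) q (2 * m) = 0 :=
    Finset.prod_eq_zero (Finset.mem_range.2 (by omega : m - 1 < 2 * m)) (by
      rw [mul_assoc, ← pow_succ', Nat.sub_add_cancel (by omega), inv_mul_cancel₀ hqm, sub_self])
  have e0 : q ^ (2 * m) * (q ^ m)⁻¹ = q ^ m := by field_simp; ring
  have s1 := sum_qBinomCoeff hq (2 * m) (t := (q ^ m)⁻¹) (by rw [e0]; exact hlt m hm)
  have s2 := sum_qBinomCoeff hq (2 * m) (t := (q ^ m)⁻¹ * q) (by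
    rw [← mul_assoc, e0, ← pow_succ]; exact hlt _ m.succ_ne_zero)
  rw [e1] at s1
  rw [e2] at s2
  have hM := qPoch_ne_zero hq hq (2 * m)
  refine mul_left_cancel₀ hM ?_
  rw [mul_zero, Finset.mul_sum]
  have : (0 : K) = ∑ k ∈ Finset.range (2 * m + 1), qBinomCoeff (q ^ (2 * m)) 1 q k * (q ^ m)⁻¹ ^ k +
    (q ^ m)⁻¹ *
      ∑ k ∈ Finset.range (2 * m + 1), qBinomCoeff (q ^ (2 * m)) 1 q k * ((q ^ m)⁻¹ * q) ^ k := by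
    rw [s1, s2]; simp
  rw [this, Finset.mul_sum, ← Finset.sum_add_distrib]
  refine Finset.sum_congr rfl fun i hi => ?_
  have hB := qBinomCoeff_eq hq (2 * m) i (by have := Finset.mem_range.1 hi; omega)
  have d1 := qPoch_ne_zero hq hq i
  have d2 := qPoch_ne_zero hq hq (2 * m - i)
  have hB' : qBinomCoeff (q ^ (2 * m)) 1 q i = qPoch q q (2 * m) *
      (qPoch q q i * qPoch q q (2 * m - i))⁻¹ * ∏ j ∈ Finset.range i, -q ^ j := by
    rw [mul_right_comm, ← hB, mul_assoc, mul_inv_cancel₀ (mul_ne_zero d1 d2), mul_one]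
  rw [hB', Finset.prod_range_succ]
  ring

/-- `∫ H_n(cos θ|q) |(e^{2iθ};q)_∞|² dθ` over a full period. -/
lemma integral_hermite (h0 : 0 < q) (h1 : q < 1) (n : ℕ) :
    ∫ θ in -Real.pi..Real.pi, asc 0 0 q (Real.cos θ) n * hermiteWeight q θ =
      if n = 0 then 4 * Real.pi / qPochInf q q else 0 := by
  have hq := norm_ofReal_lt_one h0 h1
  have hq0 : (q : ℂ) ≠ 0 := by exact_mod_cast h0.ne'
  have hlim := tendsto_integral_finiteWeight h0 h1
    (Complex.continuous_ofReal.comp (continuous_asc_cos 0 0 q n))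
  simp only [Function.comp_apply, ← Complex.ofReal_mul] at hlim
  rw [intervalIntegral.integral_ofReal] at hlim
  rcases Nat.even_or_odd' n with ⟨m, rfl | rfl⟩
  · obtain ⟨L, hL⟩ := exists_tendsto_tripleCoeff hq hq0 m
    have h2 := (tendsto_finsetSum (Finset.range (2 * m + 1)) fun i _ =>
      ((tendsto_tripleCoeff_add hq hq0 hL i).sub
        (tendsto_tripleCoeff_add hq hq0 hL (i + 1))).const_mul
          (qPoch (q : ℂ) q i * qPoch (q : ℂ) q (2 * m - i))⁻¹).const_mul (2 * (Real.pi : ℂ))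
    have h3 := tendsto_nhds_unique ((hlim.comp (tendsto_add_atTop_nat m)).congr' (by
      filter_upwards [eventually_ne_atTop 0] with N hN
      exact integral_asc_even_mul_finiteWeight h0 h1 m hN)) h2
    rw [← Complex.ofReal_inj, h3]
    rcases eq_or_ne m 0 with rfl | hm
    · have : L = (qPochInf (q : ℂ) q)⁻¹ :=
        tendsto_nhds_unique hL (tendsto_tripleCoeff_self hq hq0)
      simp [qPoch, this, ofReal_qPochInf h0 h1]
      ring
    · rw [if_neg (by omega)]
      -- The unknown limit L is a common factor of a vanishing sum.
      simp only [← mul_sub, mul_left_comm _ L, ← Finset.mul_sum]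
      rw [sum_hermite_moment_eq_zero hq hq0 hm]
      simp
  · rw [if_neg (by omega), ← Complex.ofReal_inj]
    refine tendsto_nhds_unique hlim ?_
    refine (tendsto_const_nhds (x := (0 : ℂ))).congr' ?_
    filter_upwards [eventually_ne_atTop 0] with N hN
    rw [integral_asc_mul_finiteWeight h0 h1 _ hN]
    refine (Finset.sum_eq_zero fun i _ => ?_).symm
    rw [Finset.sum_eq_zero, mul_zero]
    intro k _
    -- All frequencies are odd here, so none is zero.
    rw [if_neg (by push_cast; omega), if_neg (by push_cast; omega), sub_zero, mul_zero]

end HermiteWeight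

/-! ### From orthogonality to constants to full orthogonality. -/

section Orthogonality

/-- Orthogonality from a three term recurrence relation. -/
lemma eq_zero_of_recurrence {A : ℕ → ℕ → ℝ} {α β γ : ℕ → ℝ} (hα : ∀ n, α n ≠ 0)
    (h0 : ∀ n, A (n + 1) 0 = 0)
    (hrec : ∀ n m, α n * A (n + 1) m + β n * A n m + γ n * A (n - 1) m =
      α m * A n (m + 1) + β m * A n m + γ m * A n (m - 1)) {n m : ℕ} (h : m < n) :
    A n m = 0 := by
  induction m using Nat.strong_induction_on generalizing n with
  | _ m ih =>
    rcases m with _ | m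
    · obtain ⟨k, rfl⟩ := Nat.exists_eq_succ_of_ne_zero h.ne'
      exact h0 k
    -- All entries of this relation except A n (m + 1) have second index at most m and smaller than
    -- the first, so only α m * A n (m + 1) = 0 survives.
    · have h1 := hrec n m
      rw [ih m (by omega) (by omega : m < n + 1), ih m (by omega) (by omega : m < n),
        ih m (by omega) (by omega : m < n - 1), ih (m - 1) (by omega) (by omega : m - 1 < n)] at h1
      simpa [hα m] using h1

lemma diag_of_recurrence {A : ℕ → ℕ → ℝ} {α β γ : ℕ → ℝ} (hα : ∀ n, α n ≠ 0)
    (h0 : ∀ n, A (n + 1) 0 = 0)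
    (hrec : ∀ n m, α n * A (n + 1) m + β n * A n m + γ n * A (n - 1) m =
      α m * A n (m + 1) + β m * A n m + γ m * A n (m - 1)) (n : ℕ) :
    α n * A (n + 1) (n + 1) = γ (n + 1) * A n n := by
  have hz := fun {n m : ℕ} (h : m < n) => eq_zero_of_recurrence hα h0 hrec h
  have h1 := hrec (n + 1) n
  rw [hz (by omega : n < n + 1 + 1), hz (by omega : n < n + 1), add_tsub_cancel_right] at h1
  rcases n with _ | n
  · rw [hz (by omega : 0 - 1 < 0 + 1)] at h1; linarith
  · rw [hz (by omega : n + 1 - 1 < n + 1 + 1)] at h1; linarith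

variable {q : ℝ}

/-- The zero coefficient at n = 0 neutralizes the truncated `n - 1`, giving one form for all n. -/
lemma asc_recurrence (h0 : 0 < q) (h1 : q < 1) (a b x : ℝ) (n : ℕ) :
    (1 - q ^ (n + 1)) * asc a b q x (n + 1) + (a + b) * q ^ n * asc a b q x n +
      (if n = 0 then 0 else 1 - a * b * q ^ (n - 1)) * asc a b q x (n - 1) =
        2 * x * asc a b q x n := by
  have hq : ‖q‖ < 1 := by rwa [Real.norm_of_nonneg h0.le]
  rcases n with _ | n
  · have := asc_one hq a b x
    simp [asc] at this ⊢
    linarith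
  · have := asc_add_two hq a b x n
    simp only [Nat.add_eq_zero_iff, one_ne_zero, and_false, if_false, add_tsub_cancel_right]
    linarith

/-- Multiplication by 2 cos θ is symmetric for the pairing, so the recurrence may be applied in
either index. On the diagonal it gives the norm ratios (1 - abq^n)/(1 - q^(n+1)). -/
lemma integral_asc_mul_asc (h0 : 0 < q) (h1 : q < 1) (a b : ℝ) {W : ℝ → ℝ}
    (hW : IntervalIntegrable W volume (-Real.pi) Real.pi)
    (horth : ∀ n : ℕ, n ≠ 0 → ∫ θ in -Real.pi..Real.pi, asc a b q (Real.cos θ) n * W θ = 0)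
    (n m : ℕ) :
    ∫ θ in -Real.pi..Real.pi, asc a b q (Real.cos θ) n * asc a b q (Real.cos θ) m * W θ =
      if n = m then qPoch (a * b) q n / qPoch q q n * ∫ θ in -Real.pi..Real.pi, W θ else 0 := by
  set A : ℕ → ℕ → ℝ := fun n m => ∫ θ in -Real.pi..Real.pi,
    asc a b q (Real.cos θ) n * asc a b q (Real.cos θ) m * W θ with hA
  have hsymm : ∀ n m, A n m = A m n := fun n m => by
    simp only [hA, mul_comm (asc a b q _ n)]
  have hint : ∀ (c : ℝ) n m, IntervalIntegrable (fun θ => c * (asc a b q (Real.cos θ) n *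
      asc a b q (Real.cos θ) m * W θ)) volume (-Real.pi) Real.pi := fun c n m =>
    (hW.continuousOn_mul ((continuous_asc_cos a b q n).mul
      (continuous_asc_cos a b q m)).continuousOn).const_mul c
  set α : ℕ → ℝ := fun n => 1 - q ^ (n + 1) with hα
  set β : ℕ → ℝ := fun n => (a + b) * q ^ n with hβ
  set γ : ℕ → ℝ := fun n => if n = 0 then 0 else 1 - a * b * q ^ (n - 1) with hγ
  have hα0 : ∀ n, α n ≠ 0 := fun n => by
    have : q ^ (n + 1) < 1 := pow_lt_one₀ h0.le h1 n.succ_ne_zero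
    simp only [hα]; linarith
  have key : ∀ n m, α n * A (n + 1) m + β n * A n m + γ n * A (n - 1) m =
      ∫ θ in -Real.pi..Real.pi, 2 * Real.cos θ * asc a b q (Real.cos θ) n *
        asc a b q (Real.cos θ) m * W θ := by
    intro n m
    simp only [hA]
    rw [← intervalIntegral.integral_const_mul, ← intervalIntegral.integral_const_mul,
      ← intervalIntegral.integral_const_mul, ← intervalIntegral.integral_add (hint _ _ _)
      (hint _ _ _), ← intervalIntegral.integral_add ((hint _ _ _).add (hint _ _ _)) (hint _ _ _)]
    congr 1
    ext θ
    have := asc_recurrence h0 h1 a b (Real.cos θ) n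
    rw [← this]
    ring
  have hrec : ∀ n m, α n * A (n + 1) m + β n * A n m + γ n * A (n - 1) m =
      α m * A n (m + 1) + β m * A n m + γ m * A n (m - 1) := by
    intro n m
    rw [key, hsymm n (m + 1), hsymm n m, hsymm n (m - 1), key]
    congr 1
    ext θ
    ring
  have hA0 : ∀ n, A (n + 1) 0 = 0 := fun n => by
    simpa [hA, asc] using horth (n + 1) n.succ_ne_zero
  change A n m = _
  rcases lt_trichotomy n m with h | rfl | h
  · rw [if_neg h.ne, hsymm, eq_zero_of_recurrence hα0 hA0 hrec h]
  · rw [if_pos rfl]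
    induction n with
    | zero => simp [hA, asc, qPoch]
    | succ n ih =>
      have h2 := diag_of_recurrence hα0 hA0 hrec n
      have d := (qPoch_pos h0 h1 h1 (n + 1)).ne'
      rw [ih] at h2
      refine mul_left_cancel₀ (hα0 n) ?_
      rw [h2]
      simp only [hα, hγ, Nat.add_eq_zero_iff, one_ne_zero, and_false, if_false,
        add_tsub_cancel_right]
      rw [qPoch_succ] at d
      have d1 := left_ne_zero_of_mul d
      have d2 := right_ne_zero_of_mul d
      have e : 1 - q ^ (n + 1) = 1 - q * q ^ n := by ring
      rw [qPoch_succ, qPoch_succ, e]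
      generalize 1 - q * q ^ n = D at *
      field_simp
  · rw [if_neg h.ne', eq_zero_of_recurrence hα0 hA0 hrec h]

end Orthogonality

/-! ### Total mass and orthogonality for the Al-Salam–Chihara weight. -/

section AscWeight

variable {q : ℝ}

/-- `1/|(ae^{iθ};q)_∞|²`. -/
def ascKernel (q a θ : ℝ) : ℝ := (‖qPochInf ((a : ℂ) * circ θ) (q : ℂ)‖ ^ 2)⁻¹

lemma norm_ofReal_mul_circ (a θ : ℝ) : ‖(a : ℂ) * circ θ‖ = |a| := by
  rw [norm_mul, norm_circ, mul_one, Complex.norm_real, Real.norm_eq_abs]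

lemma ascKernel_nonneg (q a θ : ℝ) : 0 ≤ ascKernel q a θ := by unfold ascKernel; positivity

lemma continuous_ascKernel (h0 : 0 < q) (h1 : q < 1) {a : ℝ} (ha : |a| < 1) :
    Continuous (ascKernel q a) := by
  have hq := norm_ofReal_lt_one h0 h1
  refine (((continuous_qPochInf hq).comp (continuous_const.mul continuous_circ)).norm.pow 2).inv₀
    fun θ => ?_
  have := qPochInf_ne_zero hq (a := (a : ℂ) * circ θ) (by rwa [norm_ofReal_mul_circ])
  simpa using this

lemma hasSum_hermite (h0 : 0 < q) (h1 : q < 1) {a : ℝ} (ha : |a| < 1) (θ : ℝ) :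
    HasSum (fun n => asc 0 0 q (Real.cos θ) n * a ^ n) (ascKernel q a θ) := by
  have hq := norm_ofReal_lt_one h0 h1
  have hn := norm_ofReal_mul_circ a θ
  have := hasSum_asc hq 0 0 (t := (a : ℂ)) (mul_inv_cancel₀ (circ_ne_zero θ)) (two_cos_eq θ)
    (by rwa [mul_comm, hn]) (by rwa [mul_comm, ← conj_circ, norm_mul, RCLike.norm_conj, ← norm_mul,
      hn])
  have e1 : ∀ n, ((asc 0 0 q (Real.cos θ) n * a ^ n : ℝ) : ℂ) =
      asc 0 0 (q : ℂ) (Real.cos θ : ℝ) n * (a : ℂ) ^ n := fun n => by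
    rw [Complex.ofReal_mul, Complex.ofReal_pow, ofReal_asc, Complex.ofReal_zero]
  have e2 : ((ascKernel q a θ : ℝ) : ℂ) = qPochInf (0 * (a : ℂ)) (q : ℂ) *
      qPochInf (0 * (a : ℂ)) (q : ℂ) / (qPochInf (circ θ * a) (q : ℂ) *
        qPochInf ((circ θ)⁻¹ * a) (q : ℂ)) := by
    rw [ascKernel, Complex.ofReal_inv, ofReal_norm_qPochInf_sq h0 h1, map_mul, conj_circ,
      Complex.conj_ofReal, mul_comm (a : ℂ), mul_comm (a : ℂ)]
    simp [qPochInf_zero]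
  rw [← Complex.hasSum_ofReal, e2]
  simp only [e1]
  exact this

/-- The Fourier coefficients of a q-Hermite polynomial are positive, so its modulus is largest at θ
= 0. -/
lemma abs_hermite_le (h0 : 0 < q) (h1 : q < 1) (n : ℕ) (θ : ℝ) :
    |asc 0 0 q (Real.cos θ) n| ≤ asc 0 0 q 1 n := by
  have e : asc 0 0 q 1 n = ∑ k ∈ Finset.range (n + 1), (qPoch q q k * qPoch q q (n - k))⁻¹ := by
    rw [← Complex.ofReal_inj, ← Real.cos_zero, asc_hermite_eq h0 h1]
    simp [circ, qPoch]
  rw [e, ← Real.norm_eq_abs, ← Complex.norm_real, asc_hermite_eq h0 h1]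
  refine (norm_sum_le _ _).trans (Finset.sum_le_sum fun k _ => ?_)
  rw [norm_mul, norm_zpow, norm_circ, one_zpow, mul_one]
  have hp := mul_pos (qPoch_pos h0 h1 h1 k) (qPoch_pos h0 h1 h1 (n - k))
  have : (qPoch (q : ℂ) q k * qPoch (q : ℂ) q (n - k))⁻¹ =
      ((qPoch q q k * qPoch q q (n - k))⁻¹ : ℝ) := by simp [qPoch]
  rw [this, Complex.norm_real, Real.norm_of_nonneg (inv_pos.2 hp).le]

lemma hasSum_integral_hermite (h0 : 0 < q) (h1 : q < 1) {a : ℝ} (ha : |a| < 1) {g : ℝ → ℝ}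
    (hg : Continuous g) :
    HasSum (fun n => a ^ n * ∫ θ in -Real.pi..Real.pi, asc 0 0 q (Real.cos θ) n * g θ)
      (∫ θ in -Real.pi..Real.pi, ascKernel q a θ * g θ) := by
  have hs : Summable fun n => asc 0 0 q 1 n * |a| ^ n := by
    simpa using (hasSum_hermite h0 h1 (a := |a|) (by rwa [abs_abs]) 0).summable
  have := intervalIntegral.hasSum_integral_of_dominated_convergence (μ := volume)
    (a := -Real.pi) (b := Real.pi) (F := fun n θ => asc 0 0 q (Real.cos θ) n * a ^ n * g θ)
    (f := fun θ => ascKernel q a θ * g θ) (fun n θ => asc 0 0 q 1 n * |a| ^ n * |g θ|)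
    (fun n => (((continuous_asc_cos 0 0 q n).mul continuous_const).mul hg).aestronglyMeasurable)
    (fun n => Eventually.of_forall fun θ _ => ?_)
    (Eventually.of_forall fun θ _ => hs.mul_right _) ?_
    (Eventually.of_forall fun θ _ => (hasSum_hermite h0 h1 ha θ).mul_right _)
  · refine this.congr_fun fun n => ?_
    rw [← intervalIntegral.integral_const_mul]
    congr 1; ext θ; ring
  · rw [norm_mul, norm_mul, norm_pow, Real.norm_eq_abs, Real.norm_eq_abs, Real.norm_eq_abs]
    gcongr
    exact abs_hermite_le h0 h1 n θ
  · simp only [tsum_mul_right]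
    exact (continuous_const.mul hg.abs).intervalIntegrable _ _

/-- The weight `|(e^{2iθ};q)_∞/((ae^{iθ};q)_∞(be^{iθ};q)_∞)|²`. -/
def ascWeight (q a b θ : ℝ) : ℝ := ascKernel q a θ * (ascKernel q b θ * hermiteWeight q θ)

/-- Expand both kernels in q-Hermite polynomials. Orthogonality leaves the diagonal series ∑
(ab)^m/(q;q)_m, which is 1/(ab;q)_∞ by the q-binomial theorem. -/
lemma integral_ascWeight_of_lt (h0 : 0 < q) (h1 : q < 1) {a b : ℝ} (ha : |a| < 1) (hb : |b| < 1) :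
    ∫ θ in -Real.pi..Real.pi, ascWeight q a b θ =
      4 * Real.pi / (qPochInf q q * qPochInf (a * b) q) := by
  have hq : ‖q‖ < 1 := by rwa [Real.norm_of_nonneg h0.le]
  have hh := continuous_hermiteWeight h0 h1
  have hab : |a * b| < 1 := by
    rw [abs_mul]; exact mul_lt_one_of_nonneg_of_lt_one_left (abs_nonneg a) ha hb.le
  have hH := fun n m => integral_asc_mul_asc h0 h1 0 0 (W := hermiteWeight q)
    (hh.intervalIntegrable _ _)
    (fun n hn => by rw [integral_hermite h0 h1, if_neg hn]) n m
  have e0 : ∫ θ in -Real.pi..Real.pi, hermiteWeight q θ = 4 * Real.pi / qPochInf q q := by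
    have := integral_hermite h0 h1 0
    simpa [asc] using this
  have key : ∀ m, ∫ θ in -Real.pi..Real.pi, asc 0 0 q (Real.cos θ) m *
      (ascKernel q b θ * hermiteWeight q θ) =
        b ^ m * (1 / qPoch q q m * (4 * Real.pi / qPochInf q q)) := by
    intro m
    have h := hasSum_integral_hermite h0 h1 hb
      (g := fun θ => asc 0 0 q (Real.cos θ) m * hermiteWeight q θ)
      ((continuous_asc_cos 0 0 q m).mul hh)
    simp only [← mul_assoc, hH] at h
    have h' := (hasSum_single m fun n hn => by rw [if_neg hn, mul_zero]).unique h
    rw [if_pos rfl, e0, mul_zero] at h'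
    rw [show qPoch 0 q m = 1 by simp [qPoch]] at h'
    rw [h']
    congr 1; ext θ; ring
  have h2 := hasSum_integral_hermite h0 h1 ha
    (g := fun θ => ascKernel q b θ * hermiteWeight q θ) ((continuous_ascKernel h0 h1 hb).mul hh)
  simp only [key] at h2
  have h3 := (hasSum_qBinomCoeff hq 1 0 (t := a * b) (by rwa [one_mul])).mul_left
    (4 * Real.pi / qPochInf q q)
  refine h2.unique ?_
  rw [zero_mul, qPochInf_zero, one_mul, div_mul_div_comm, mul_one] at h3
  refine h3.congr_fun fun n => ?_
  have : qBinomCoeff 1 0 q n = 1 / qPoch q q n := by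
    simp only [qBinomCoeff, zero_mul, sub_zero]
    rw [Finset.prod_div_distrib, Finset.prod_const_one, qPoch]
    simp only [pow_succ']
  rw [this]; ring

lemma norm_qPochInf_le (h0 : 0 < q) (h1 : q < 1) {a : ℂ} (ha : ‖a‖ ≤ 1) :
    ‖qPochInf a (q : ℂ)‖ ≤ Real.exp (1 - q)⁻¹ :=
  le_of_tendsto' (tendsto_qPoch (norm_ofReal_lt_one h0 h1) a).norm
    fun n => norm_qPoch_le h0 h1 ha n

lemma qPochInf_norm_le (h0 : 0 < q) (h1 : q < 1) {a : ℂ} (ha : ‖a‖ < 1) :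
    qPochInf ‖a‖ q ≤ ‖qPochInf a (q : ℂ)‖ := by
  have hq : ‖q‖ < 1 := by rwa [Real.norm_of_nonneg h0.le]
  refine le_of_tendsto_of_tendsto' (tendsto_qPoch hq ‖a‖)
    (tendsto_qPoch (norm_ofReal_lt_one h0 h1) a).norm fun n => ?_
  rw [qPoch, qPoch, norm_prod]
  refine Finset.prod_le_prod (fun j _ => ?_) fun j _ => ?_
  · have := pow_le_one₀ (n := j) h0.le h1.le
    have := pow_nonneg h0.le j
    nlinarith [norm_nonneg a]
  · have := norm_sub_norm_le (1 : ℂ) (a * (q : ℂ) ^ j)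
    rwa [norm_one, norm_mul, norm_pow, Complex.norm_real, Real.norm_of_nonneg h0.le] at this

/-- Uniformity up to a = 1 is the point: the zero of 1 - e^{2iθ} at θ = 0 compensates the
near-vanishing of 1 - ae^{iθ}. This gives integrability at a = 1 and domination in the limit a → 1.
-/
lemma ascWeight_le (h0 : 0 < q) (h1 : q < 1) {b : ℝ} (hb : |b| < 1) :
    ∃ C, ∀ a θ : ℝ, 0 ≤ a → a ≤ 1 → ascWeight q a b θ ≤ C := by
  have hq := norm_ofReal_lt_one h0 h1
  have hQ : 0 < qPochInf q q := qPochInf_pos h0 h1 (by rwa [abs_of_pos h0])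
  have hB : 0 < qPochInf |b| q := qPochInf_pos h0 h1 (by rwa [abs_abs])
  set M := Real.exp (1 - q)⁻¹
  refine ⟨(qPochInf q q ^ 2)⁻¹ * 16 * ((qPochInf |b| q ^ 2)⁻¹ * M ^ 2), fun a θ ha0 ha1 => ?_⟩
  have hz := norm_circ θ
  have e1 : ‖qPochInf (circ θ ^ 2) (q : ℂ)‖ ≤ ‖1 - circ θ ^ 2‖ * M := by
    rw [qPochInf_eq_mul hq, norm_mul]
    gcongr
    refine norm_qPochInf_le h0 h1 ?_
    rw [norm_mul, norm_pow, hz, one_pow, one_mul]; exact hq.le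
  have e2 : ‖1 - (a : ℂ) * circ θ‖ * qPochInf q q ≤ ‖qPochInf ((a : ℂ) * circ θ) (q : ℂ)‖ := by
    rw [qPochInf_eq_mul hq, norm_mul]
    gcongr
    have hn : ‖(a : ℂ) * circ θ * q‖ = a * q := by
      rw [norm_mul, norm_ofReal_mul_circ, abs_of_nonneg ha0, Complex.norm_real,
        Real.norm_of_nonneg h0.le]
    have haq : a * q ≤ q := mul_le_of_le_one_left h0.le ha1
    refine le_trans ?_ (qPochInf_norm_le h0 h1 (by rw [hn]; linarith))
    rw [hn]
    have hq' : ‖q‖ < 1 := by rwa [Real.norm_of_nonneg h0.le]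
    refine le_of_tendsto_of_tendsto' (tendsto_qPoch hq' q) (tendsto_qPoch hq' (a * q)) fun n => ?_
    refine Finset.prod_le_prod (fun j _ => ?_) fun j _ => ?_
    · have := pow_le_one₀ (n := j) h0.le h1.le
      have := pow_nonneg h0.le j
      nlinarith
    · gcongr
  have e3 : qPochInf |b| q ≤ ‖qPochInf ((b : ℂ) * circ θ) (q : ℂ)‖ := by
    have := qPochInf_norm_le h0 h1 (a := (b : ℂ) * circ θ) (by rwa [norm_ofReal_mul_circ])
    rwa [norm_ofReal_mul_circ] at this
  have e4 : ‖1 - circ θ ^ 2‖ ≤ 4 * ‖1 - (a : ℂ) * circ θ‖ := by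
    have f1 : ‖1 - circ θ ^ 2‖ ≤ 2 * ‖1 - circ θ‖ := by
      rw [show 1 - circ θ ^ 2 = (1 + circ θ) * (1 - circ θ) by ring, norm_mul]
      gcongr
      refine (norm_add_le _ _).trans ?_
      rw [hz, norm_one]; norm_num
    have f2 : ‖1 - circ θ‖ ≤ ‖1 - (a : ℂ) * circ θ‖ + (1 - a) := by
      rw [show 1 - circ θ = (1 - (a : ℂ) * circ θ) - ((1 - a : ℝ) : ℂ) * circ θ by
        push_cast; ring]
      refine (norm_sub_le _ _).trans ?_
      rw [norm_ofReal_mul_circ, abs_of_nonneg (by linarith)]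
    have f3 : 1 - a ≤ ‖1 - (a : ℂ) * circ θ‖ := by
      have := norm_sub_norm_le (1 : ℂ) ((a : ℂ) * circ θ)
      rwa [norm_one, norm_ofReal_mul_circ, abs_of_nonneg ha0] at this
    linarith
  have e5 : ascKernel q a θ * hermiteWeight q θ ≤ (qPochInf q q ^ 2)⁻¹ * 16 * M ^ 2 := by
    rw [ascKernel, hermiteWeight]
    -- Where the denominator vanishes, the kernel is 0 by the convention for inverses.
    rcases eq_or_ne ‖1 - (a : ℂ) * circ θ‖ 0 with h | h
    · have : ‖qPochInf ((a : ℂ) * circ θ) (q : ℂ)‖ = 0 := by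
        rw [qPochInf_eq_mul hq, norm_mul, h, zero_mul]
      rw [this]
      simp only [ne_eq, OfNat.ofNat_ne_zero, not_false_eq_true, zero_pow, inv_zero, zero_mul]
      positivity
    · have h : 0 < ‖1 - (a : ℂ) * circ θ‖ := lt_of_le_of_ne (norm_nonneg _) h.symm
      calc _ ≤ ((‖1 - (a : ℂ) * circ θ‖ * qPochInf q q) ^ 2)⁻¹ *
            (4 * ‖1 - (a : ℂ) * circ θ‖ * M) ^ 2 := by
            gcongr
            exact e1.trans (by gcongr)
        _ = _ := by field_simp; ring
  calc ascWeight q a b θ = ascKernel q b θ * (ascKernel q a θ * hermiteWeight q θ) := by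
        rw [ascWeight]; ring
    _ ≤ (qPochInf |b| q ^ 2)⁻¹ * ((qPochInf q q ^ 2)⁻¹ * 16 * M ^ 2) := by
        have : 0 ≤ hermiteWeight q θ := by unfold hermiteWeight; positivity
        have h5 := ascKernel_nonneg q a θ
        rw [ascKernel]
        gcongr
    _ = _ := by ring

lemma qPochInf_circ_ne_zero (h0 : 0 < q) (h1 : q < 1) {a θ : ℝ} (ha : |a| ≤ 1)
    (h : (a : ℂ) * circ θ ≠ 1) : qPochInf ((a : ℂ) * circ θ) (q : ℂ) ≠ 0 := by
  have hq := norm_ofReal_lt_one h0 h1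
  rw [qPochInf_eq_mul hq]
  refine mul_ne_zero (sub_ne_zero.2 h.symm) (qPochInf_ne_zero hq ?_)
  rw [norm_mul, norm_ofReal_mul_circ]
  exact mul_lt_one_of_nonneg_of_lt_one_right ha (norm_nonneg _) hq

lemma circ_ne_one {θ : ℝ} (h : θ ≠ 0) (h' : θ ∈ Set.uIoc (-Real.pi) Real.pi) : circ θ ≠ 1 := by
  intro hz
  rw [Set.uIoc_of_le (by linarith [Real.pi_pos])] at h'
  have := congrArg Complex.re hz
  rw [circ, Complex.exp_ofReal_mul_I_re, Complex.one_re] at this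
  exact h ((Real.cos_eq_one_iff_of_lt_of_lt (by linarith [h'.1, Real.pi_pos])
    (by linarith [h'.2, Real.pi_pos])).1 this)

lemma measurable_ascWeight (h0 : 0 < q) (h1 : q < 1) (a b : ℝ) : Measurable (ascWeight q a b) := by
  have hc := continuous_qPochInf (norm_ofReal_lt_one h0 h1)
  have hk : ∀ a, Measurable (ascKernel q a) := fun a =>
    (((hc.comp (continuous_const.mul continuous_circ)).norm.pow 2).measurable).inv
  exact (hk a).mul ((hk b).mul (continuous_hermiteWeight h0 h1).measurable)

lemma ascWeight_nonneg (q a b θ : ℝ) : 0 ≤ ascWeight q a b θ := by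
  unfold ascWeight hermiteWeight
  have := ascKernel_nonneg q a θ
  have := ascKernel_nonneg q b θ
  positivity

lemma intervalIntegrable_ascWeight (h0 : 0 < q) (h1 : q < 1) {a b : ℝ} (ha0 : 0 ≤ a) (ha1 : a ≤ 1)
    (hb : |b| < 1) : IntervalIntegrable (ascWeight q a b) volume (-Real.pi) Real.pi := by
  obtain ⟨C, hC⟩ := ascWeight_le h0 h1 hb
  refine (intervalIntegrable_const (c := C)).mono_fun
    (measurable_ascWeight h0 h1 a b).aestronglyMeasurable (Eventually.of_forall fun θ => ?_)
  change ‖ascWeight q a b θ‖ ≤ ‖C‖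
  rw [Real.norm_of_nonneg (ascWeight_nonneg q a b θ)]
  exact (hC a θ ha0 ha1).trans (le_abs_self C)

/-- The total mass of the Al-Salam–Chihara weight. -/
lemma integral_ascWeight (h0 : 0 < q) (h1 : q < 1) {a b : ℝ} (ha0 : 0 ≤ a) (ha1 : a ≤ 1)
    (hb : |b| < 1) : ∫ θ in -Real.pi..Real.pi, ascWeight q a b θ =
      4 * Real.pi / (qPochInf q q * qPochInf (a * b) q) := by
  rcases ha1.lt_or_eq with ha | rfl
  · exact integral_ascWeight_of_lt h0 h1 (by rwa [abs_of_nonneg ha0]) hb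
  have hq := norm_ofReal_lt_one h0 h1
  have hq' : ‖q‖ < 1 := by rwa [Real.norm_of_nonneg h0.le]
  obtain ⟨C, hC⟩ := ascWeight_le h0 h1 hb
  -- The value a = 1 is approached along a = 1 - q^n; pointwise convergence may fail only at the
  -- singular point θ = 0, a null set.
  have hu0 : ∀ n : ℕ, 0 ≤ 1 - q ^ n := fun n => by linarith [pow_le_one₀ (n := n) h0.le h1.le]
  have hu1 : ∀ n : ℕ, 1 - q ^ n < 1 := fun n => by linarith [pow_pos h0 n]
  have hu : Tendsto (fun n : ℕ => 1 - q ^ n) atTop (𝓝 1) := by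
    simpa using (tendsto_pow_atTop_nhds_zero_of_lt_one h0.le h1).const_sub 1
  have l1 : Tendsto (fun n : ℕ => ∫ θ in -Real.pi..Real.pi, ascWeight q (1 - q ^ n) b θ) atTop
      (𝓝 (∫ θ in -Real.pi..Real.pi, ascWeight q 1 b θ)) := by
    refine intervalIntegral.tendsto_integral_filter_of_dominated_convergence (fun _ => C)
      (Eventually.of_forall fun n => (measurable_ascWeight h0 h1 _ b).aestronglyMeasurable)
      (Eventually.of_forall fun n => Eventually.of_forall fun θ _ => ?_)
      intervalIntegrable_const ?_
    · rw [Real.norm_of_nonneg (ascWeight_nonneg _ _ _ θ)]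
      exact hC _ θ (hu0 n) (hu1 n).le
    · filter_upwards [compl_mem_ae_iff.2 (measure_singleton (0 : ℝ))] with θ h h'
      refine Tendsto.mul_const _ ?_
      have hne := qPochInf_circ_ne_zero h0 h1 (a := 1) (θ := θ) (by simp)
        (by simpa using circ_ne_one h h')
      refine Tendsto.inv₀ (Tendsto.pow (Tendsto.norm ?_) 2) (by simpa using hne)
      refine ((continuous_qPochInf hq).tendsto _).comp (Tendsto.mul_const _ ?_)
      exact (Complex.continuous_ofReal.tendsto 1).comp hu
  have l2 : Tendsto (fun n : ℕ => 4 * Real.pi / (qPochInf q q * qPochInf ((1 - q ^ n) * b) q)) atTop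
      (𝓝 (4 * Real.pi / (qPochInf q q * qPochInf (1 * b) q))) := by
    refine tendsto_const_nhds.div (Tendsto.const_mul _ ?_) ?_
    · exact ((continuous_qPochInf hq').tendsto _).comp (hu.mul_const b)
    · refine mul_ne_zero (qPochInf_ne_zero hq' hq') (qPochInf_ne_zero hq' ?_)
      rwa [one_mul, Real.norm_eq_abs]
  refine tendsto_nhds_unique l1 (l2.congr fun n => ?_)
  rw [integral_ascWeight_of_lt h0 h1 (by rw [abs_of_nonneg (hu0 n)]; exact hu1 n) hb]

/-- The polynomial is |(ae^{iθ};q)_k|² and cancels the first k factors of the denominator, provided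
none of them is zero. -/
lemma qPochPair_mul_ascWeight (h0 : 0 < q) (h1 : q < 1) {a θ : ℝ} (ha : |a| ≤ 1) (b : ℝ)
    (h : (a : ℂ) * circ θ ≠ 1) (k : ℕ) :
    qPochPair a q (Real.cos θ) k * ascWeight q a b θ = ascWeight q (a * q ^ k) b θ := by
  have hq := norm_ofReal_lt_one h0 h1
  have hne := qPochInf_circ_ne_zero h0 h1 ha h
  have e1 : qPochPair a q (Real.cos θ) k = ‖qPoch ((a : ℂ) * circ θ) (q : ℂ) k‖ ^ 2 := by
    rw [qPoch, norm_prod, ← Finset.prod_pow, qPochPair]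
    refine Finset.prod_congr rfl fun j _ => ?_
    have h2 := two_cos_eq θ
    have h3 := mul_inv_cancel₀ (circ_ne_zero θ)
    rw [← Complex.ofReal_inj, ← Complex.normSq_eq_norm_sq, ← Complex.mul_conj]
    simp only [map_sub, map_mul, map_one, map_pow, conj_circ, Complex.conj_ofReal,
      Complex.ofReal_sub, Complex.ofReal_add, Complex.ofReal_mul, Complex.ofReal_pow,
      Complex.ofReal_one, Complex.ofReal_ofNat]
    linear_combination -(a : ℂ) * (q : ℂ) ^ j * h2 - ((a : ℂ) * (q : ℂ) ^ j) ^ 2 * h3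
  have e2 := qPochInf_eq_qPoch_mul hq ((a : ℂ) * circ θ) k
  rw [e2] at hne
  have n1 := norm_ne_zero_iff.2 (left_ne_zero_of_mul hne)
  have n2 := norm_ne_zero_iff.2 (right_ne_zero_of_mul hne)
  have e3 : ((a * q ^ k : ℝ) : ℂ) * circ θ = (a : ℂ) * circ θ * (q : ℂ) ^ k := by
    push_cast; ring
  rw [ascWeight, ascWeight, ascKernel, ascKernel, ascKernel, e1, e2, e3, norm_mul]
  field_simp

/-- The factor (c;q)_k cancels, and the remaining sum is (q^(1-n);q)_n by the terminating q-binomial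
theorem, with a zero factor at j = n - 1. -/
lemma sum_phiCoeff_eq_zero (h0 : 0 < q) (h1 : q < 1) {c : ℝ} (hc : c < 1) {n : ℕ} (hn : n ≠ 0) :
    ∑ k ∈ Finset.range (n + 1), phiCoeff c q n k * qPoch c q k = 0 := by
  have hq : ‖q‖ < 1 := by rwa [Real.norm_of_nonneg h0.le]
  have hqn : q ^ n ≠ 0 := (pow_pos h0 n).ne'
  have h := sum_qBinomCoeff hq n (t := (q ^ n)⁻¹ * q) (by
    rwa [← mul_assoc, mul_inv_cancel₀ hqn, one_mul])
  have hz : qPoch ((q ^ n)⁻¹ * q) q n = 0 :=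
    Finset.prod_eq_zero (Finset.mem_range.2 (by omega : n - 1 < n)) (by
      rw [mul_assoc, ← pow_succ', Nat.sub_add_cancel (by omega), inv_mul_cancel₀ hqn, sub_self])
  rw [hz] at h
  rw [← h]
  refine Finset.sum_congr rfl fun k _ => ?_
  have e : qBinomCoeff (q ^ n) 1 q k = qPoch ((q ^ n)⁻¹) q k * (q ^ n) ^ k / qPoch q q k := by
    rw [qBinomCoeff, Finset.prod_div_distrib, qPoch, qPoch]
    simp only [pow_succ']
    congr 1
    rw [show (q ^ n) ^ k = ∏ j ∈ Finset.range k, q ^ n by simp, ← Finset.prod_mul_distrib]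
    refine Finset.prod_congr rfl fun j _ => ?_
    field_simp
  have d1 := (qPoch_pos h0 h1 hc k).ne'
  have d2 := (qPoch_pos h0 h1 h1 k).ne'
  have e3 : ((q ^ n)⁻¹) ^ k * (q ^ n) ^ k = 1 := by
    rw [← mul_pow, inv_mul_cancel₀ hqn, one_pow]
  have e4 : qPoch ((q ^ n)⁻¹) q k * (q ^ n) ^ k / qPoch q q k * ((q ^ n)⁻¹ * q) ^ k =
      qPoch ((q ^ n)⁻¹) q k / qPoch q q k * q ^ k * (((q ^ n)⁻¹) ^ k * (q ^ n) ^ k) := by ring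
  rw [e, phiCoeff, e4, e3]
  field_simp

/-- Each term of the ₃φ₂ turns the weight into the one with aq^k, whose mass is (ab;q)_k times the
original mass; `sum_phiCoeff_eq_zero` then applies. -/
lemma integral_asc_mul_ascWeight (h0 : 0 < q) (h1 : q < 1) {a b : ℝ} (ha0 : 0 < a) (ha1 : a ≤ 1)
    (hb : |b| < 1) {n : ℕ} (hn : n ≠ 0) :
    ∫ θ in -Real.pi..Real.pi, asc a b q (Real.cos θ) n * ascWeight q a b θ = 0 := by
  have hq' : ‖q‖ < 1 := by rwa [Real.norm_of_nonneg h0.le]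
  have ha : |a| ≤ 1 := by rwa [abs_of_pos ha0]
  have hab' : |a * b| < 1 := by
    rw [abs_mul]; exact mul_lt_one_of_nonneg_of_lt_one_right ha (abs_nonneg b) hb
  have hab : a * b < 1 := (abs_lt.1 hab').2
  have hk0 : ∀ k : ℕ, 0 ≤ a * q ^ k := fun k => mul_nonneg ha0.le (pow_nonneg h0.le k)
  have hk1 : ∀ k : ℕ, a * q ^ k ≤ 1 := fun k =>
    mul_le_one₀ ha1 (pow_nonneg h0.le k) (pow_le_one₀ h0.le h1.le)
  have hae : ∀ᵐ θ : ℝ, θ ∈ Set.uIoc (-Real.pi) Real.pi →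
      a ^ n * (asc a b q (Real.cos θ) n * ascWeight q a b θ) =
        qPoch (a * b) q n / qPoch q q n * ∑ k ∈ Finset.range (n + 1),
          phiCoeff (a * b) q n k * ascWeight q (a * q ^ k) b θ := by
    filter_upwards [compl_mem_ae_iff.2 (measure_singleton (0 : ℝ))] with θ h h'
    have hne : (a : ℂ) * circ θ ≠ 1 := by
      intro hz
      have := norm_ofReal_mul_circ a θ
      rw [hz, norm_one, abs_of_pos ha0] at this
      rw [← this, Complex.ofReal_one, one_mul] at hz
      exact circ_ne_one h h' hz
    rw [← mul_assoc, ← asc_eq_phiSum h0 h1 ha0.ne' hab, phiSum, mul_assoc, Finset.sum_mul]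
    congr 1
    refine Finset.sum_congr rfl fun k _ => ?_
    rw [mul_assoc, qPochPair_mul_ascWeight h0 h1 ha b hne]
  have hI : ∀ k : ℕ, ∫ θ in -Real.pi..Real.pi, ascWeight q (a * q ^ k) b θ =
      4 * Real.pi / (qPochInf q q * qPochInf (a * b) q) * qPoch (a * b) q k := by
    intro k
    rw [integral_ascWeight h0 h1 (hk0 k) (hk1 k) hb, qPochInf_eq_qPoch_mul hq' (a * b) k]
    have d1 := (qPoch_pos h0 h1 hab k).ne'
    have d2 : qPochInf (a * b * q ^ k) q ≠ 0 := qPochInf_ne_zero hq' (by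
      rw [norm_mul, norm_pow]
      exact mul_lt_one_of_nonneg_of_lt_one_left (norm_nonneg _) hab'
        (pow_le_one₀ (norm_nonneg _) hq'.le))
    have d3 := qPochInf_ne_zero hq' hq'
    rw [show a * q ^ k * b = a * b * q ^ k by ring]
    field_simp
  refine (mul_eq_zero.1 ?_).resolve_left (pow_pos ha0 n).ne'
  rw [← intervalIntegral.integral_const_mul, intervalIntegral.integral_congr_ae hae,
    intervalIntegral.integral_const_mul, intervalIntegral.integral_finsetSum fun k _ =>
      (intervalIntegrable_ascWeight h0 h1 (hk0 k) (hk1 k) hb).const_mul _]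
  simp only [intervalIntegral.integral_const_mul, hI]
  simp only [mul_left_comm (phiCoeff _ _ _ _), ← Finset.mul_sum]
  rw [sum_phiCoeff_eq_zero h0 h1 hab hn]
  simp

/-- The orthogonality of the Al-Salam–Chihara polynomials. -/
lemma asc_orthogonality (h0 : 0 < q) (h1 : q < 1) {a b : ℝ} (ha0 : 0 < a) (ha1 : a ≤ 1)
    (hb : |b| < 1) (n m : ℕ) :
    ∫ θ in -Real.pi..Real.pi, asc a b q (Real.cos θ) n * asc a b q (Real.cos θ) m *
        ascWeight q a b θ =
      if n = m then qPoch (a * b) q n / qPoch q q n *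
        (4 * Real.pi / (qPochInf q q * qPochInf (a * b) q)) else 0 := by
  rw [integral_asc_mul_asc h0 h1 a b (intervalIntegrable_ascWeight h0 h1 ha0.le ha1 hb)
    fun n hn => integral_asc_mul_ascWeight h0 h1 ha0 ha1 hb hn, integral_ascWeight h0 h1 ha0.le ha1
    hb]

end AscWeight

/-! ### Normalization constants and the expansion of ξ. -/

section Expansion

variable {q l : ℝ}

lemma rpow_mul_rpow_param (h0 : 0 < q) (l : ℝ) :
    q ^ (l - 1 / 4) * q ^ (l + 1 / 4) = q ^ (2 * l) := by
  rw [← Real.rpow_add h0]; ring_nf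

lemma rpow_two_mul_lt_one (h0 : 0 < q) (h1 : q < 1) (hl : 1 / 4 ≤ l) : q ^ (2 * l) < 1 :=
  Real.rpow_lt_one h0.le h1 (by linarith)

lemma p_eq_asc (h0 : 0 < q) (h1 : q < 1) (hl : 1 / 4 ≤ l) (n : ℕ) (t : ℝ) :
    p q l n t = √(qPoch q q n / qPoch (q ^ (2 * l)) q n) *
      asc (q ^ (l - 1 / 4)) (q ^ (l + 1 / 4)) q (nu q t) n := by
  have e : q ^ ((1 / 4 - l) * n) * (q ^ (l - 1 / 4)) ^ n = 1 := by
    rw [← Real.rpow_mul_natCast h0.le, ← Real.rpow_add h0]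
    ring_nf; exact Real.rpow_zero q
  rw [p, P_eq_asc h0 h1 (by linarith), Real.sqrt_div (qPoch_pos h0 h1 h1 n).le]
  linear_combination √(qPoch q q n) / √(qPoch (q ^ (2 * l)) q n) *
    asc (q ^ (l - 1 / 4)) (q ^ (l + 1 / 4)) q (nu q t) n * e

lemma qNum_div (h0 : 0 < q) (h1 : q < 1) (l : ℝ) (n : ℕ) :
    qNum q (2 * l + (n + 1 : ℕ) - 1) / qNum q (n + 1 : ℕ) =
      (q ^ ((1 - 2 * l) / 4)) ^ 2 * ((1 - q ^ (2 * l) * q ^ n) / (1 - q * q ^ n)) := by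
  have hd : q ^ (1 / 2 : ℝ) - q ^ (-1 / 2 : ℝ) ≠ 0 :=
    (sub_neg.2 (Real.rpow_lt_rpow_of_exponent_gt h0 h1 (by norm_num))).ne
  have e : ∀ a : ℝ, q ^ (a / 2) - q ^ (-a / 2) = -(q ^ (-a / 2) * (1 - q ^ a)) := by
    intro a
    have : q ^ (-a / 2) * q ^ a = q ^ (a / 2) := by
      rw [← Real.rpow_add h0]; ring_nf
    linear_combination -this
  have e1 : q ^ (2 * l + (n + 1 : ℕ) - 1) = q ^ (2 * l) * q ^ n := by
    rw [← Real.rpow_natCast, ← Real.rpow_add h0]; push_cast; ring_nf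
  have e2 : q ^ ((n + 1 : ℕ) : ℝ) = q * q ^ n := by rw [Real.rpow_natCast, pow_succ']
  have e3 : q ^ (-(2 * l + (n + 1 : ℕ) - 1) / 2) =
      (q ^ ((1 - 2 * l) / 4)) ^ 2 * q ^ (-((n + 1 : ℕ) : ℝ) / 2) := by
    rw [← Real.rpow_mul_natCast h0.le, ← Real.rpow_add h0]; push_cast; ring_nf
  have hne : q ^ (-((n + 1 : ℕ) : ℝ) / 2) ≠ 0 := (Real.rpow_pos_of_pos h0 _).ne'
  have hn : 1 - q * q ^ n ≠ 0 := by
    rw [← pow_succ']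
    have : q ^ (n + 1) < 1 := pow_lt_one₀ h0.le h1 n.succ_ne_zero
    linarith
  rw [qNum, qNum, div_div_div_cancel_right₀ hd, e, e, e1, e2, e3]
  generalize 1 - q * q ^ n = D at *
  field_simp

lemma c_eq (h0 : 0 < q) (h1 : q < 1) (hl : 1 / 4 ≤ l) (n : ℕ) :
    c q l n = (q ^ ((1 - 2 * l) / 4)) ^ n * √(qPoch (q ^ (2 * l)) q n / qPoch q q n) := by
  induction n with
  | zero => simp [c, qPoch]
  | succ n ih =>
    have hs : c q l (n + 1) = c q l n *
        (√(qNum q (2 * l + (n + 1 : ℕ) - 1)) / √(qNum q (n + 1 : ℕ))) :=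
      Finset.prod_Icc_succ_top (by omega) _
    have hpos : 0 ≤ qNum q (2 * l + (n + 1 : ℕ) - 1) :=
      (qNum_pos h0 h1 (by push_cast; linarith [n.cast_nonneg (α := ℝ)])).le
    rw [hs, ih, ← Real.sqrt_div hpos, qNum_div h0 h1, Real.sqrt_mul (sq_nonneg _),
      Real.sqrt_sq (Real.rpow_pos_of_pos h0 _).le, qPoch_succ, qPoch_succ, mul_div_mul_comm,
      Real.sqrt_mul (div_pos (qPoch_pos h0 h1 (rpow_two_mul_lt_one h0 h1 hl) n)
        (qPoch_pos h0 h1 h1 n)).le]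
    ring

/-- The square roots in p_n and c_n are reciprocal, so p_n f_n is a term of the generating function
at q^((1-2l)/4) x. -/
lemma p_mul_c (h0 : 0 < q) (h1 : q < 1) (hl : 1 / 4 ≤ l) (n : ℕ) (t : ℝ) :
    p q l n t * c q l n = asc (q ^ (l - 1 / 4)) (q ^ (l + 1 / 4)) q (nu q t) n *
      (q ^ ((1 - 2 * l) / 4)) ^ n := by
  have d1 := qPoch_pos h0 h1 (rpow_two_mul_lt_one h0 h1 hl) n
  have d2 := qPoch_pos h0 h1 h1 n
  have : √(qPoch q q n / qPoch (q ^ (2 * l)) q n) * √(qPoch (q ^ (2 * l)) q n / qPoch q q n) =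
      1 := by
    rw [← Real.sqrt_mul (div_pos d2 d1).le, div_mul_div_cancel₀ d1.ne', div_self d2.ne',
      Real.sqrt_one]
  rw [p_eq_asc h0 h1 hl, c_eq h0 h1 hl]
  linear_combination asc (q ^ (l - 1 / 4)) (q ^ (l + 1 / 4)) q (nu q t) n *
      (q ^ ((1 - 2 * l) / 4)) ^ n * this

/-- `nu` uses the left form of the scale and `what` the right one. -/
lemma kappa_eq (h0 : 0 < q) : q ^ (-1 / 2 : ℝ) - q ^ (1 / 2 : ℝ) = q ^ (-1 / 2 : ℝ) * (1 - q) := by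
  have : q ^ (-1 / 2 : ℝ) * q = q ^ (1 / 2 : ℝ) := by
    conv_lhs => rw [← Real.rpow_one q, ← Real.rpow_mul h0.le, ← Real.rpow_add h0]
    norm_num
  linear_combination this

lemma kappa_pos (h0 : 0 < q) (h1 : q < 1) : 0 < q ^ (-1 / 2 : ℝ) - q ^ (1 / 2 : ℝ) := by
  rw [kappa_eq h0]
  exact mul_pos (Real.rpow_pos_of_pos h0 _) (by linarith)

lemma rpow_half_inv (h0 : 0 < q) : (q ^ (1 / 2 : ℝ))⁻¹ = q ^ (-1 / 2 : ℝ) := by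
  rw [← Real.rpow_neg h0.le]; norm_num

lemma endpt_eq (h0 : 0 < q) :
    endpt q = 2 / (q ^ (-1 / 2 : ℝ) - q ^ (1 / 2 : ℝ)) := by
  have := Real.rpow_pos_of_pos h0 (1 / 2)
  rw [kappa_eq h0, endpt, ← rpow_half_inv h0]
  field_simp

lemma nu_mem_Icc (h0 : 0 < q) (h1 : q < 1) {t : ℝ} (ht : t ∈ Set.Icc 0 (endpt q)) :
    nu q t ∈ Set.Icc (-1 : ℝ) 1 := by
  have hk := kappa_pos h0 h1
  rw [endpt_eq h0, Set.mem_Icc, le_div_iff₀ hk] at ht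
  rw [nu, Set.mem_Icc]
  constructor
  · linarith [ht.2]
  · nlinarith [ht.1]

lemma expTheta_eq (y : ℝ) : expTheta y = circ (Real.arccos y) := by
  rw [expTheta, circ, mul_comm]

/-- The expansion of the generalized eigenfunctions. -/
lemma hasSum_xi (h0 : 0 < q) (h1 : q < 1) (hl : 1 / 4 ≤ l) {t : ℝ}
    (ht : t ∈ Set.Icc 0 (endpt q)) {x : ℂ} (hx : ‖x‖ < q ^ ((2 * l - 1) / 4)) :
    HasSum (fun n : ℕ => (p q l n t : ℂ) * ((c q l n : ℂ) * x ^ n)) (xi q l t x) := by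
  have hν := nu_mem_Icc h0 h1 ht
  have hz := expTheta_eq (nu q t)
  have hnx : ‖((q ^ ((1 - 2 * l) / 4) : ℝ) : ℂ) * x‖ < 1 := by
    have hp := Real.rpow_pos_of_pos h0 ((1 - 2 * l) / 4)
    rw [norm_mul, Complex.norm_real, Real.norm_of_nonneg hp.le]
    calc _ < q ^ ((1 - 2 * l) / 4) * q ^ ((2 * l - 1) / 4) := by gcongr
      _ = 1 := by rw [← Real.rpow_add h0]; ring_nf; exact Real.rpow_zero q
  have h2 : 2 * ((nu q t : ℝ) : ℂ) = expTheta (nu q t) + (expTheta (nu q t))⁻¹ := by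
    rw [hz, ← two_cos_eq, Real.cos_arccos hν.1 hν.2]
  have hn1 : ‖expTheta (nu q t)‖ = 1 := by rw [hz, norm_circ]
  have h := hasSum_asc (norm_ofReal_lt_one h0 h1) ((q ^ (l - 1 / 4) : ℝ) : ℂ)
    ((q ^ (l + 1 / 4) : ℝ) : ℂ) (t := ((q ^ ((1 - 2 * l) / 4) : ℝ) : ℂ) * x)
    (mul_inv_cancel₀ (by rw [hz]; exact circ_ne_zero _)) h2
    (by rwa [norm_mul, hn1, one_mul]) (by rwa [norm_mul, norm_inv, hn1, inv_one, one_mul])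
  have e1 : ((q ^ (l - 1 / 4) : ℝ) : ℂ) * (((q ^ ((1 - 2 * l) / 4) : ℝ) : ℂ) * x) =
      ((q ^ (l / 2) : ℝ) : ℂ) * x := by
    rw [← mul_assoc, ← Complex.ofReal_mul, ← Real.rpow_add h0]; ring_nf
  have e2 : ((q ^ (l + 1 / 4) : ℝ) : ℂ) * (((q ^ ((1 - 2 * l) / 4) : ℝ) : ℂ) * x) =
      ((q ^ ((l + 1) / 2) : ℝ) : ℂ) * x := by
    rw [← mul_assoc, ← Complex.ofReal_mul, ← Real.rpow_add h0]; ring_nf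
  rw [e1, e2, mul_left_comm (expTheta _), mul_left_comm (expTheta _)⁻¹, ← mul_assoc, ← mul_assoc] at h
  rw [xi]
  simp only [mul_assoc] at h ⊢
  refine h.congr_fun fun n => ?_
  have h3 := congrArg Complex.ofReal (p_mul_c h0 h1 hl n t)
  rw [Complex.ofReal_mul, Complex.ofReal_mul, ofReal_asc, Complex.ofReal_pow] at h3
  rw [mul_pow]
  linear_combination x ^ n * h3

end Expansion

/-! ### Change of variables to θ and orthonormality. -/

section WeightMeasure

variable {q l : ℝ}

lemma continuous_expTheta : Continuous expTheta := by
  unfold expTheta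
  exact Complex.continuous_exp.comp (continuous_const.mul
    (Complex.continuous_ofReal.comp Real.continuous_arccos))

/-- In base q^(1/2) the numerator combines to (e^{2iθ};q)_∞, and the denominator splits by parity of
the exponent into parameters q^(l-1/4) and q^(l-1/4) q^(1/2) = q^(l+1/4). -/
lemma w_cos (h0 : 0 < q) (h1 : q < 1) (l : ℝ) {θ : ℝ} (hθ0 : 0 ≤ θ) (hθ1 : θ ≤ Real.pi) :
    w q l (Real.cos θ) = ascWeight q (q ^ (l - 1 / 4)) (q ^ (l + 1 / 4)) θ := by
  have hs : ‖((√q : ℝ) : ℂ)‖ < 1 := norm_ofReal_lt_one (Real.sqrt_pos.2 h0)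
    (by rw [Real.sqrt_lt' one_pos]; simpa using h1)
  have hsq : ((√q : ℝ) : ℂ) ^ 2 = (q : ℂ) := by
    rw [← Complex.ofReal_pow, Real.sq_sqrt h0.le]
  have hb : ((q ^ (l - 1 / 4) : ℝ) : ℂ) * ((√q : ℝ) : ℂ) = ((q ^ (l + 1 / 4) : ℝ) : ℂ) := by
    rw [← Complex.ofReal_mul, Real.sqrt_eq_rpow, ← Real.rpow_add h0]; ring_nf
  rw [w, expTheta_eq, Real.arccos_cos hθ0 hθ1, qPochInf_sq hs, ← qPochInf_even_odd hs, hsq,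
    mul_right_comm, hb, ascWeight, ascKernel, ascKernel, hermiteWeight, norm_div, norm_mul]
  rw [div_pow, mul_pow, div_eq_mul_inv, mul_inv]
  ring

lemma measurable_what (h0 : 0 < q) (h1 : q < 1) (l : ℝ) : Measurable (what q l) := by
  have hs : ‖((√q : ℝ) : ℂ)‖ < 1 := norm_ofReal_lt_one (Real.sqrt_pos.2 h0)
    (by rw [Real.sqrt_lt' one_pos]; simpa using h1)
  have hc := continuous_qPochInf hs
  have he := continuous_expTheta
  have hw : Measurable (w q l) := by
    refine Measurable.pow_const (Measurable.norm (Measurable.div ?_ ?_)) 2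
    · exact ((hc.comp he).mul (hc.comp he.neg)).measurable
    · exact (hc.comp (continuous_const.mul he)).measurable
  have hw' : Measurable fun t => w q l (1 - q ^ (-1 / 2 : ℝ) * (1 - q) * t) :=
    hw.comp (by fun_prop)
  unfold what
  fun_prop

lemma qPochInf_param_pos (h0 : 0 < q) (h1 : q < 1) (hl : 1 / 4 ≤ l) :
    0 < qPochInf (q ^ (2 * l)) q :=
  qPochInf_pos h0 h1 (by
    rw [abs_of_pos (Real.rpow_pos_of_pos h0 _)]; exact rpow_two_mul_lt_one h0 h1 hl)

lemma what_nonneg (h0 : 0 < q) (h1 : q < 1) (hl : 1 / 4 ≤ l) (t : ℝ) : 0 ≤ what q l t := by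
  have h2 := (qPochInf_pos h0 h1 (by rwa [abs_of_pos h0])).le
  have h3 := (qPochInf_param_pos h0 h1 hl).le
  unfold what w
  positivity

/-- The spectral variable `λ = (1 - cos θ)/(q^{-1/2} - q^{1/2})`. -/
def lam (q θ : ℝ) : ℝ := (1 - Real.cos θ) / (q ^ (-1 / 2 : ℝ) - q ^ (1 / 2 : ℝ))

lemma nu_lam (h0 : 0 < q) (h1 : q < 1) (θ : ℝ) : nu q (lam q θ) = Real.cos θ := by
  have := (kappa_pos h0 h1).ne'
  rw [nu, lam, mul_div_cancel₀ _ this]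
  ring

lemma hasDerivAt_lam (q θ : ℝ) :
    HasDerivAt (lam q) (Real.sin θ / (q ^ (-1 / 2 : ℝ) - q ^ (1 / 2 : ℝ))) θ := by
  have := ((Real.hasDerivAt_cos θ).const_sub 1).div_const
    (q ^ (-1 / 2 : ℝ) - q ^ (1 / 2 : ℝ))
  rwa [neg_neg] at this

lemma injOn_lam (h0 : 0 < q) (h1 : q < 1) : Set.InjOn (lam q) (Set.Ioo 0 Real.pi) := by
  intro x hx y hy hxy
  have := congrArg (nu q) hxy
  rw [nu_lam h0 h1, nu_lam h0 h1] at this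
  exact Real.injOn_cos ⟨hx.1.le, hx.2.le⟩ ⟨hy.1.le, hy.2.le⟩ this

lemma image_lam (h0 : 0 < q) (h1 : q < 1) :
    lam q '' Set.Ioo 0 Real.pi = Set.Ioo 0 (endpt q) := by
  have hk := kappa_pos h0 h1
  rw [endpt_eq h0]
  ext t
  constructor
  · rintro ⟨θ, hθ, rfl⟩
    have c1 : Real.cos θ < 1 := by
      rw [← Real.cos_zero]
      exact Real.strictAntiOn_cos ⟨le_rfl, Real.pi_pos.le⟩ ⟨hθ.1.le, hθ.2.le⟩ hθ.1
    have c2 : -1 < Real.cos θ := by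
      rw [← Real.cos_pi]
      exact Real.strictAntiOn_cos ⟨hθ.1.le, hθ.2.le⟩ ⟨Real.pi_pos.le, le_rfl⟩ hθ.2
    exact ⟨div_pos (by linarith) hk, div_lt_div_of_pos_right (by linarith) hk⟩
  · rintro ⟨ht0, ht1⟩
    rw [lt_div_iff₀ hk] at ht1
    have hm := mul_pos ht0 hk
    refine ⟨Real.arccos (nu q t), ⟨?_, ?_⟩, ?_⟩
    · rw [Real.arccos_pos, nu]; linarith
    · refine lt_of_le_of_ne (Real.arccos_le_pi _) fun h => ?_
      rw [Real.arccos_eq_pi, nu] at h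
      linarith
    · rw [lam, Real.cos_arccos (by rw [nu]; linarith) (by rw [nu]; linarith), nu, sub_sub_cancel,
        mul_div_cancel_left₀ _ hk.ne']

/-- The square roots in the weight contribute κ/(√(1 - cos θ) √(1 + cos θ)) = κ/sin θ with κ =
q^(-1/2) - q^(1/2), which cancels the Jacobian. -/
lemma deriv_lam_mul_what (h0 : 0 < q) (h1 : q < 1) (l : ℝ) {θ : ℝ}
    (hθ : θ ∈ Set.Ioo 0 Real.pi) :
    |Real.sin θ / (q ^ (-1 / 2 : ℝ) - q ^ (1 / 2 : ℝ))| * what q l (lam q θ) =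
      1 / (2 * Real.pi) * qPochInf q q * qPochInf (q ^ (2 * l)) q *
        ascWeight q (q ^ (l - 1 / 4)) (q ^ (l + 1 / 4)) θ := by
  have hk := kappa_pos h0 h1
  have hsin := Real.sin_pos_of_pos_of_lt_pi hθ.1 hθ.2
  have e1 : q ^ (-1 / 2 : ℝ) * (1 - q) * lam q θ = 1 - Real.cos θ := by
    rw [← kappa_eq h0, lam, mul_div_cancel₀ _ hk.ne']
  have e2 : (1 - q) / (lam q θ * q ^ (1 / 2 : ℝ)) =
      (q ^ (-1 / 2 : ℝ) - q ^ (1 / 2 : ℝ)) ^ 2 / (1 - Real.cos θ) := by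
    have hq := (Real.rpow_pos_of_pos h0 (1 / 2)).ne'
    have : (1 - q) / (lam q θ * q ^ (1 / 2 : ℝ)) =
        (q ^ (-1 / 2 : ℝ) - q ^ (1 / 2 : ℝ)) / lam q θ := by
      rw [kappa_eq h0, ← rpow_half_inv h0]
      rw [div_mul_eq_div_div, div_right_comm, div_eq_mul_inv (1 - q), mul_comm (1 - q)]
    rw [this, lam, div_div_eq_mul_div, sq]
  have c1 : 0 ≤ 1 - Real.cos θ := by linarith [Real.cos_le_one θ]
  have c2 : 0 ≤ 1 + Real.cos θ := by linarith [Real.neg_one_le_cos θ]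
  have e3 : √(1 - Real.cos θ) * √(1 + Real.cos θ) = Real.sin θ := by
    rw [← Real.sqrt_mul c1, ← Real.sqrt_sq hsin.le]
    congr 1
    linear_combination -Real.sin_sq_add_cos_sq θ
  rw [what, e1, e2, sub_sub_cancel, w_cos h0 h1 l hθ.1.le hθ.2.le,
    show 2 - (1 - Real.cos θ) = 1 + Real.cos θ by ring, Real.sqrt_div (sq_nonneg _),
    Real.sqrt_sq hk.le, abs_of_pos (div_pos hsin hk)]
  rw [← e3] at hsin ⊢
  have d1 := left_ne_zero_of_mul hsin.ne'
  have d2 := right_ne_zero_of_mul hsin.ne'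
  generalize q ^ (-1 / 2 : ℝ) - q ^ (1 / 2 : ℝ) = κ at *
  have hk' := hk.ne'
  field_simp

lemma param_bounds (h0 : 0 < q) (h1 : q < 1) (hl : 1 / 4 ≤ l) :
    0 < q ^ (l - 1 / 4) ∧ q ^ (l - 1 / 4) ≤ 1 ∧ |q ^ (l + 1 / 4)| < 1 := by
  refine ⟨Real.rpow_pos_of_pos h0 _, Real.rpow_le_one h0.le h1.le (by linarith), ?_⟩
  rw [abs_of_pos (Real.rpow_pos_of_pos h0 _)]
  exact Real.rpow_lt_one h0.le h1 (by linarith)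

lemma integrableOn_what (h0 : 0 < q) (h1 : q < 1) (hl : 1 / 4 ≤ l) :
    IntegrableOn (what q l) (Set.Icc 0 (endpt q)) := by
  obtain ⟨ha0, ha1, hb⟩ := param_bounds h0 h1 hl
  rw [integrableOn_Icc_iff_integrableOn_Ioo, ← image_lam h0 h1,
    integrableOn_image_iff_integrableOn_abs_deriv_smul measurableSet_Ioo
      (fun θ _ => (hasDerivAt_lam q θ).hasDerivWithinAt) (injOn_lam h0 h1)]
  have h2 := (intervalIntegrable_ascWeight h0 h1 ha0.le ha1 hb).const_mul
    (1 / (2 * Real.pi) * qPochInf q q * qPochInf (q ^ (2 * l)) q)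
  rw [intervalIntegrable_iff_integrableOn_Ioo_of_le (by linarith [Real.pi_pos])] at h2
  refine IntegrableOn.congr_fun (h2.mono_set
    (Set.Ioo_subset_Ioo_left (by linarith [Real.pi_pos]))) (fun θ hθ => ?_) measurableSet_Ioo
  rw [smul_eq_mul, deriv_lam_mul_what h0 h1 l hθ]

lemma isFiniteMeasure_weightMeasure (h0 : 0 < q) (h1 : q < 1) (hl : 1 / 4 ≤ l) :
    IsFiniteMeasure (weightMeasure q l) :=
  isFiniteMeasure_withDensity_ofReal (integrableOn_what h0 h1 hl).2

lemma ae_weightMeasure_mem (q l : ℝ) : ∀ᵐ t ∂weightMeasure q l, t ∈ Set.Icc 0 (endpt q) :=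
  (withDensity_absolutelyContinuous _ _).ae_le (ae_restrict_mem measurableSet_Icc)

lemma integral_weightMeasure (h0 : 0 < q) (h1 : q < 1) (hl : 1 / 4 ≤ l) (g : ℝ → ℝ) :
    ∫ t, g t ∂weightMeasure q l = 1 / (2 * Real.pi) * qPochInf q q * qPochInf (q ^ (2 * l)) q *
      ∫ θ in (0)..Real.pi, g (lam q θ) * ascWeight q (q ^ (l - 1 / 4)) (q ^ (l + 1 / 4)) θ := by
  rw [weightMeasure, integral_withDensity_eq_integral_toReal_smul
    (measurable_what h0 h1 l).ennreal_ofReal (Eventually.of_forall fun _ => ENNReal.ofReal_lt_top),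
    integral_Icc_eq_integral_Ioo, ← image_lam h0 h1,
    integral_image_eq_integral_abs_deriv_smul measurableSet_Ioo
      (fun θ _ => (hasDerivAt_lam q θ).hasDerivWithinAt) (injOn_lam h0 h1),
    intervalIntegral.integral_of_le Real.pi_pos.le, integral_Ioc_eq_integral_Ioo,
    ← integral_const_mul]
  refine setIntegral_congr_fun measurableSet_Ioo fun θ hθ => ?_
  simp only [smul_eq_mul]
  rw [ENNReal.toReal_ofReal (what_nonneg h0 h1 hl _), ← mul_assoc, deriv_lam_mul_what h0 h1 l hθ]
  ring

lemma ascWeight_neg (h0 : 0 < q) (h1 : q < 1) (a b θ : ℝ) :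
    ascWeight q a b (-θ) = ascWeight q a b θ := by
  have h : ∀ x : ℂ, ‖qPochInf (starRingEnd ℂ x) (q : ℂ)‖ = ‖qPochInf x (q : ℂ)‖ := fun x => by
    rw [← conj_qPochInf h0 h1, RCLike.norm_conj]
  have h1 : ∀ a : ℝ, (a : ℂ) * (circ θ)⁻¹ = starRingEnd ℂ ((a : ℂ) * circ θ) := fun a => by
    rw [map_mul, conj_circ, Complex.conj_ofReal]
  have h2 : ((circ θ)⁻¹) ^ 2 = starRingEnd ℂ (circ θ ^ 2) := by rw [map_pow, conj_circ]
  simp only [ascWeight, ascKernel, hermiteWeight, circ_neg, h1, h2, h]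

lemma integral_even {g : ℝ → ℝ} {R : ℝ} (hg : ∀ θ, g (-θ) = g θ)
    (hi : IntervalIntegrable g volume (-R) R) (hR : 0 ≤ R) :
    ∫ θ in (0)..R, g θ = (∫ θ in (-R)..R, g θ) / 2 := by
  have e : ∫ θ in (-R)..0, g θ = ∫ θ in (0)..R, g θ := by
    have := intervalIntegral.integral_comp_neg (a := 0) (b := R) g
    simp only [hg, neg_zero] at this
    exact this.symm
  have h1 : IntervalIntegrable g volume (-R) 0 := hi.mono_set (by
    rw [Set.uIcc_of_le (by linarith), Set.uIcc_of_le (by linarith)]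
    exact Set.Icc_subset_Icc_right hR)
  have h2 : IntervalIntegrable g volume 0 R := hi.mono_set (by
    rw [Set.uIcc_of_le (by linarith), Set.uIcc_of_le (by linarith)]
    exact Set.Icc_subset_Icc_left (by linarith))
  rw [← intervalIntegral.integral_add_adjacent_intervals h1 h2, e]
  ring

/-- The integrand is even in θ, so half of the full-period mass, with its 4π, meets the prefactor
1/(2π); the infinite products and square roots cancel as well. -/
lemma integral_p_mul_p (h0 : 0 < q) (h1 : q < 1) (hl : 1 / 4 ≤ l) (n m : ℕ) :
    ∫ t, p q l n t * p q l m t ∂weightMeasure q l = if n = m then 1 else 0 := by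
  obtain ⟨ha0, ha1, hb⟩ := param_bounds h0 h1 hl
  have hI := intervalIntegrable_ascWeight h0 h1 ha0.le ha1 hb
  have e : ∀ θ, p q l n (lam q θ) * p q l m (lam q θ) *
      ascWeight q (q ^ (l - 1 / 4)) (q ^ (l + 1 / 4)) θ =
      (√(qPoch q q n / qPoch (q ^ (2 * l)) q n) * √(qPoch q q m / qPoch (q ^ (2 * l)) q m)) *
        (asc (q ^ (l - 1 / 4)) (q ^ (l + 1 / 4)) q (Real.cos θ) n *
          asc (q ^ (l - 1 / 4)) (q ^ (l + 1 / 4)) q (Real.cos θ) m *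
            ascWeight q (q ^ (l - 1 / 4)) (q ^ (l + 1 / 4)) θ) := fun θ => by
    rw [p_eq_asc h0 h1 hl, p_eq_asc h0 h1 hl, nu_lam h0 h1]
    ring
  rw [integral_weightMeasure h0 h1 hl]
  simp only [e]
  have heven := integral_even (g := fun θ =>
      asc (q ^ (l - 1 / 4)) (q ^ (l + 1 / 4)) q (Real.cos θ) n *
        asc (q ^ (l - 1 / 4)) (q ^ (l + 1 / 4)) q (Real.cos θ) m *
          ascWeight q (q ^ (l - 1 / 4)) (q ^ (l + 1 / 4)) θ)
    (fun θ => by rw [Real.cos_neg, ascWeight_neg h0 h1])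
    (hI.continuousOn_mul ((continuous_asc_cos _ _ q n).mul
      (continuous_asc_cos _ _ q m)).continuousOn) Real.pi_pos.le
  rw [intervalIntegral.integral_const_mul, heven,
    asc_orthogonality h0 h1 ha0 ha1 hb, rpow_mul_rpow_param h0]
  split_ifs with h
  · subst h
    have d1 := (qPoch_pos h0 h1 (rpow_two_mul_lt_one h0 h1 hl) n)
    have d2 := (qPoch_pos h0 h1 h1 n)
    have d3 := (qPochInf_pos h0 h1 (a := q) (by rwa [abs_of_pos h0])).ne'
    have d4 := (qPochInf_param_pos h0 h1 hl).ne'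
    rw [Real.mul_self_sqrt (div_pos d2 d1).le]
    have d1' := d1.ne'
    have d2' := d2.ne'
    have := Real.pi_pos.ne'
    field_simp
    norm_num
  · simp

end WeightMeasure

/-! ### Density of polynomials and the Hilbert basis. -/

section Completeness

variable {q l : ℝ}

lemma memLp_of_continuous {μ : Measure ℝ} [IsFiniteMeasure μ] {a b : ℝ}
    (hμ : ∀ᵐ t ∂μ, t ∈ Set.Icc a b) {f : ℝ → ℂ} (hf : Continuous f) (r : ℝ≥0∞) : MemLp f r μ := by
  obtain ⟨C, hC⟩ := isCompact_Icc.exists_bound_of_continuousOn (hf.continuousOn (s := Set.Icc a b))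
  exact MemLp.of_bound hf.aestronglyMeasurable C (hμ.mono hC)

/-- A family of functions whose span contains the
polynomials is total in `L²` of a finite measure on a compact interval. -/
lemma span_toLp_dense {μ : Measure ℝ} [IsFiniteMeasure μ] {a b : ℝ}
    (hμ : ∀ᵐ t ∂μ, t ∈ Set.Icc a b) {ι : Type*} {v : ι → ℝ → ℂ} (hv : ∀ i, MemLp (v i) 2 μ)
    (hpoly : ∀ P : Polynomial ℝ, (fun t => ((P.eval t : ℝ) : ℂ)) ∈
      Submodule.span ℂ (Set.range v)) :
    ⊤ ≤ (Submodule.span ℂ (Set.range fun i => (hv i).toLp (v i))).topologicalClosure := by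
  set S := Submodule.span ℂ (Set.range fun i => (hv i).toLp (v i)) with hS
  have hmem : ∀ f ∈ Submodule.span ℂ (Set.range v), ∃ hf : MemLp f 2 μ, hf.toLp f ∈ S := by
    intro f hf
    induction hf using Submodule.span_induction with
    | mem f hf =>
      obtain ⟨i, rfl⟩ := hf
      exact ⟨hv i, Submodule.subset_span ⟨i, rfl⟩⟩
    | zero => exact ⟨MemLp.zero', by rw [MemLp.toLp_zero]; exact S.zero_mem⟩
    | add f g _ _ hf hg =>
      obtain ⟨hf, hf'⟩ := hf
      obtain ⟨hg, hg'⟩ := hg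
      exact ⟨hf.add hg, by rw [MemLp.toLp_add hf hg]; exact S.add_mem hf' hg'⟩
    | smul r f _ hf =>
      obtain ⟨hf, hf'⟩ := hf
      exact ⟨hf.const_smul r, by rw [MemLp.toLp_const_smul r hf]; exact S.smul_mem r hf'⟩
  intro F _
  rw [← SetLike.mem_coe, Submodule.topologicalClosure_coe, EMetric.mem_closure_iff]
  intro ε hε
  have hμ1 : μ Set.univ ^ ((2 : ℝ≥0∞).toReal)⁻¹ ≠ ∞ :=
    ENNReal.rpow_ne_top_of_nonneg (by norm_num) (measure_ne_top μ _)
  obtain ⟨ε', hε'0, hε'⟩ := exists_between hε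
  -- The uniform error will be 2δ: one δ each for the real and the imaginary part, approximated
  -- separately by Weierstrass.
  obtain ⟨δ, hδ, hδ'⟩ : ∃ δ : ℝ, 0 < δ ∧
      μ Set.univ ^ ((2 : ℝ≥0∞).toReal)⁻¹ * ENNReal.ofReal (2 * δ) ≤ ε' / 2 := by
    have hpos : 0 < ε' / 2 := ENNReal.half_pos hε'0.ne'
    have hlim : Tendsto (fun δ : ℝ => μ Set.univ ^ ((2 : ℝ≥0∞).toReal)⁻¹ *
        ENNReal.ofReal (2 * δ)) (𝓝[>] 0) (𝓝 (μ Set.univ ^ ((2 : ℝ≥0∞).toReal)⁻¹ *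
          ENNReal.ofReal (2 * 0))) := by
      refine (ENNReal.Tendsto.const_mul ?_ (Or.inr hμ1)).mono_left nhdsWithin_le_nhds
      exact (ENNReal.continuous_ofReal.tendsto _).comp ((continuous_const_mul 2).tendsto 0)
    rw [mul_zero, ENNReal.ofReal_zero, mul_zero] at hlim
    obtain ⟨δ, h1, h2⟩ := ((hlim.eventually_le_const hpos).and self_mem_nhdsWithin).exists
    exact ⟨δ, h2, h1⟩
  obtain ⟨g, hg, hgL⟩ := (Lp.memLp F).exists_boundedContinuous_eLpNorm_sub_le
    (by norm_num) (ENNReal.half_pos hε'0.ne').ne'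
  obtain ⟨P₁, hP₁⟩ := exists_polynomial_near_of_continuousOn a b (fun t => (g t).re)
    (Complex.continuous_re.comp g.continuous).continuousOn δ hδ
  obtain ⟨P₂, hP₂⟩ := exists_polynomial_near_of_continuousOn a b (fun t => (g t).im)
    (Complex.continuous_im.comp g.continuous).continuousOn δ hδ
  set h : ℝ → ℂ := (fun t => ((P₁.eval t : ℝ) : ℂ)) +
    Complex.I • (fun t => ((P₂.eval t : ℝ) : ℂ)) with hh
  obtain ⟨hhL, hhS⟩ := hmem h (Submodule.add_mem _ (hpoly P₁) (Submodule.smul_mem _ _ (hpoly P₂)))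
  refine ⟨hhL.toLp h, hhS, lt_of_le_of_lt ?_ hε'⟩
  rw [← Lp.toLp_coeFn F (Lp.memLp F), Lp.edist_toLp_toLp]
  have hgh : eLpNorm (⇑g - h) 2 μ ≤ ε' / 2 := by
    refine le_trans (eLpNorm_le_of_ae_bound (C := 2 * δ) ?_) hδ'
    filter_upwards [hμ] with t ht
    have e : (⇑g - h) t = (((g t).re - P₁.eval t : ℝ) : ℂ) +
        (((g t).im - P₂.eval t : ℝ) : ℂ) * Complex.I := by
      simp only [hh, Pi.sub_apply, Pi.add_apply, Pi.smul_apply, smul_eq_mul]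
      conv_lhs => rw [← Complex.re_add_im (g t)]
      push_cast
      ring
    rw [e]
    refine (norm_add_le _ _).trans ?_
    rw [norm_mul, Complex.norm_I, mul_one, Complex.norm_real, Complex.norm_real, Real.norm_eq_abs,
      Real.norm_eq_abs, abs_sub_comm, abs_sub_comm (g t).im]
    linarith [hP₁ t ht, hP₂ t ht]
  calc eLpNorm (⇑F - h) 2 μ = eLpNorm ((⇑F - ⇑g) + (⇑g - h)) 2 μ := by rw [sub_add_sub_cancel]
    _ ≤ eLpNorm (⇑F - ⇑g) 2 μ + eLpNorm (⇑g - h) 2 μ :=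
        eLpNorm_add_le ((Lp.aestronglyMeasurable F).sub hgL.aestronglyMeasurable)
          (hgL.aestronglyMeasurable.sub hhL.aestronglyMeasurable) (by norm_num)
    _ ≤ ε' / 2 + ε' / 2 := add_le_add hg hgh
    _ = ε' := ENNReal.add_halves ε'

lemma asc_nu_mem_span (h0 : 0 < q) (h1 : q < 1) (hl : 1 / 4 ≤ l) (n : ℕ) :
    (fun t => ((asc (q ^ (l - 1 / 4)) (q ^ (l + 1 / 4)) q (nu q t) n : ℝ) : ℂ)) ∈
      Submodule.span ℂ (Set.range fun (n : ℕ) (t : ℝ) => (p q l n t : ℂ)) := by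
  have hs : √(qPoch q q n / qPoch (q ^ (2 * l)) q n) ≠ 0 := (Real.sqrt_pos.2
    (div_pos (qPoch_pos h0 h1 h1 n) (qPoch_pos h0 h1 (rpow_two_mul_lt_one h0 h1 hl) n))).ne'
  have : (fun t => ((asc (q ^ (l - 1 / 4)) (q ^ (l + 1 / 4)) q (nu q t) n : ℝ) : ℂ)) =
      ((√(qPoch q q n / qPoch (q ^ (2 * l)) q n) : ℝ) : ℂ)⁻¹ • fun t : ℝ => (p q l n t : ℂ) := by
    ext t
    rw [Pi.smul_apply, p_eq_asc h0 h1 hl, smul_eq_mul, Complex.ofReal_mul,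
      inv_mul_cancel_left₀ (by exact_mod_cast hs)]
  rw [this]
  exact Submodule.smul_mem _ _ (Submodule.subset_span ⟨n, rfl⟩)

/-- The recurrence expresses 2ν p_n through neighbouring polynomials, and ν = 1 - κλ can be solved
for λ because κ ≠ 0. -/
lemma mul_mem_span_p (h0 : 0 < q) (h1 : q < 1) (hl : 1 / 4 ≤ l) {f : ℝ → ℂ}
    (hf : f ∈ Submodule.span ℂ (Set.range fun (n : ℕ) (t : ℝ) => (p q l n t : ℂ))) :
    (fun t : ℝ => (t : ℂ) * f t) ∈
      Submodule.span ℂ (Set.range fun (n : ℕ) (t : ℝ) => (p q l n t : ℂ)) := by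
  set V := Submodule.span ℂ (Set.range fun (n : ℕ) (t : ℝ) => (p q l n t : ℂ)) with hV
  induction hf using Submodule.span_induction with
  | mem f hf =>
    obtain ⟨n, rfl⟩ := hf
    have hr := asc_nu_mem_span h0 h1 hl (l := l)
    set r : ℕ → ℝ → ℂ := fun n t =>
      ((asc (q ^ (l - 1 / 4)) (q ^ (l + 1 / 4)) q (nu q t) n : ℝ) : ℂ) with hrdef
    set s : ℝ := √(qPoch q q n / qPoch (q ^ (2 * l)) q n)
    set κ : ℝ := q ^ (-1 / 2 : ℝ) - q ^ (1 / 2 : ℝ) with hκ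
    have hk : κ ≠ 0 := (kappa_pos h0 h1).ne'
    have hk' : (κ : ℂ) ≠ 0 := by exact_mod_cast hk
    set β : ℝ := (q ^ (l - 1 / 4) + q ^ (l + 1 / 4)) * q ^ n
    set γ : ℝ := if n = 0 then 0 else 1 - q ^ (l - 1 / 4) * q ^ (l + 1 / 4) * q ^ (n - 1)
    have e : (fun t : ℝ => (t : ℂ) * (p q l n t : ℂ)) =
        ((s : ℂ) * (2 * (κ : ℂ))⁻¹) • ((2 : ℂ) • r n - ((1 - (q : ℂ) ^ (n + 1)) • r (n + 1) +
          (β : ℂ) • r n + (γ : ℂ) • r (n - 1))) := by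
      ext t
      have h2 := congrArg Complex.ofReal
        (asc_recurrence h0 h1 (q ^ (l - 1 / 4)) (q ^ (l + 1 / 4)) (nu q t) n)
      have h3 : ((nu q t : ℝ) : ℂ) = 1 - (κ : ℂ) * t := by rw [nu, ← hκ]; push_cast; ring
      change (((1 - q ^ (n + 1)) * _ + β * _ + γ * _ : ℝ) : ℂ) = _ at h2
      simp only [Complex.ofReal_add, Complex.ofReal_mul, Complex.ofReal_sub, Complex.ofReal_one,
        Complex.ofReal_pow, Complex.ofReal_ofNat, h3] at h2
      rw [p_eq_asc h0 h1 hl]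
      simp only [Pi.smul_apply, Pi.sub_apply, Pi.add_apply, smul_eq_mul, hrdef]
      rw [h2, Complex.ofReal_mul]
      field_simp
      ring
    change (fun t : ℝ => (t : ℂ) * (p q l n t : ℂ)) ∈ V
    rw [e]
    exact V.smul_mem _ (V.sub_mem (V.smul_mem _ (hr n)) (V.add_mem (V.add_mem
      (V.smul_mem _ (hr _)) (V.smul_mem _ (hr _))) (V.smul_mem _ (hr _))))
  | zero =>
    have := V.zero_mem
    convert this using 1
    ext t; simp
  | add f g _ _ hf hg =>
    have := V.add_mem hf hg
    convert this using 1
    ext t; simp [mul_add]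
  | smul c f _ hf =>
    have := V.smul_mem c hf
    convert this using 1
    ext t; simp [mul_left_comm]

/-- The span contains 1 and is stable under multiplication by λ, so no degree count is needed. -/
lemma polynomial_mem_span_p (h0 : 0 < q) (h1 : q < 1) (hl : 1 / 4 ≤ l) (P : Polynomial ℝ) :
    (fun t => ((P.eval t : ℝ) : ℂ)) ∈
      Submodule.span ℂ (Set.range fun (n : ℕ) (t : ℝ) => (p q l n t : ℂ)) := by
  set V := Submodule.span ℂ (Set.range fun (n : ℕ) (t : ℝ) => (p q l n t : ℂ)) with hV
  induction P using Polynomial.induction_on' with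
  | add P Q hP hQ =>
    have := V.add_mem hP hQ
    convert this using 1
    ext t; simp
  | monomial n a =>
    have hpow : (fun t : ℝ => (t : ℂ) ^ n) ∈ V := by
      induction n with
      | zero => simpa [asc] using asc_nu_mem_span h0 h1 hl 0
      | succ n ih => simpa [pow_succ'] using mul_mem_span_p h0 h1 hl ih
    have := V.smul_mem (a : ℂ) hpow
    convert this using 1
    ext t; simp

lemma continuous_p (h0 : 0 < q) (h1 : q < 1) (hl : 1 / 4 ≤ l) (n : ℕ) :
    Continuous (p q l n) := by
  have hν : Continuous (nu q) := by unfold nu; fun_prop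
  have : p q l n = fun t => √(qPoch q q n / qPoch (q ^ (2 * l)) q n) *
      asc (q ^ (l - 1 / 4)) (q ^ (l + 1 / 4)) q (nu q t) n := funext fun t => p_eq_asc h0 h1 hl n t
  rw [this]
  exact continuous_const.mul ((continuous_asc _ _ q n).comp hν)

lemma memLp_p (h0 : 0 < q) (h1 : q < 1) (hl : 1 / 4 ≤ l) (n : ℕ) :
    MemLp (fun t : ℝ => (p q l n t : ℂ)) 2 (weightMeasure q l) := by
  have := isFiniteMeasure_weightMeasure h0 h1 hl
  exact memLp_of_continuous (ae_weightMeasure_mem q l)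
    (Complex.continuous_ofReal.comp (continuous_p h0 h1 hl n)) 2

lemma orthonormal_p (h0 : 0 < q) (h1 : q < 1) (hl : 1 / 4 ≤ l) :
    Orthonormal ℂ fun n => (memLp_p h0 h1 hl n).toLp (fun t : ℝ => (p q l n t : ℂ)) := by
  rw [orthonormal_iff_ite]
  intro n m
  rw [L2.inner_def]
  have e : ∀ᵐ t ∂weightMeasure q l, inner ℂ
      ((memLp_p h0 h1 hl n).toLp (fun t : ℝ => (p q l n t : ℂ)) t)
      ((memLp_p h0 h1 hl m).toLp (fun t : ℝ => (p q l m t : ℂ)) t) =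
        ((p q l n t * p q l m t : ℝ) : ℂ) := by
    filter_upwards [(memLp_p h0 h1 hl n).coeFn_toLp, (memLp_p h0 h1 hl m).coeFn_toLp] with t h h'
    rw [h, h', RCLike.inner_apply, Complex.conj_ofReal, Complex.ofReal_mul, mul_comm]
  rw [integral_congr_ae e, integral_complex_ofReal, integral_p_mul_p h0 h1 hl]
  split_ifs <;> simp

/-- The polynomials `p_n` as a Hilbert basis. -/
def hilbertBasisP (h0 : 0 < q) (h1 : q < 1) (hl : 1 / 4 ≤ l) :
    HilbertBasis ℕ ℂ (Lp ℂ 2 (weightMeasure q l)) :=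
  haveI := isFiniteMeasure_weightMeasure h0 h1 hl
  HilbertBasis.mk (orthonormal_p h0 h1 hl)
    (span_toLp_dense (ae_weightMeasure_mem q l) (memLp_p h0 h1 hl)
      (polynomial_mem_span_p h0 h1 hl))

lemma Hl.coord_surjective (q l : ℝ) (h : Admissible q l) :
    Function.Surjective (Hl.coord q l h) := by
  intro a
  have hc : ∀ n, (c q l n : ℂ) ≠ 0 := fun n => by exact_mod_cast (c_pos h n).ne'
  have e : ∀ n, bcoef q l n (PowerSeries.mk fun n => (c q l n : ℂ) * a n) = a n := fun n => by
    simp [bcoef, hc n]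
  refine ⟨⟨PowerSeries.mk fun n => (c q l n : ℂ) * a n, ?_⟩, ?_⟩
  · have := (memlp_iff _).1 (lp.memℓp a)
    change Summable fun n => ‖bcoef q l n _‖ ^ 2
    simpa only [e] using this
  · ext n
    exact e n

/-- The coordinate map as an isometric isomorphism onto `ℓ²`. -/
def Hl.coordIso (q l : ℝ) (h : Admissible q l) : Hl q l h ≃ₗᵢ[ℂ] lp (fun _ : ℕ => ℂ) 2 :=
  LinearIsometryEquiv.ofSurjective ⟨Hl.coord q l h, fun _ => rfl⟩ (Hl.coord_surjective q l h)

end Completeness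

end QLaguerre

end
-- The main theorem.
theorem proposition1 (q l : ℝ) (hq0 : 0 < q) (hq1 : q < 1) (hl : 1 / 4 ≤ l) :
    (∀ t ∈ Set.Icc 0 (QLaguerre.endpt q), ∀ x : ℂ, ‖x‖ < q ^ ((2 * l - 1) / 4) →
      HasSum (fun n : ℕ => (QLaguerre.p q l n t : ℂ) * ((QLaguerre.c q l n : ℂ) * x ^ n))
        (QLaguerre.xi q l t x)) ∧
    ∃ hp : ∀ n : ℕ, MemLp (fun t : ℝ => (QLaguerre.p q l n t : ℂ)) 2
        (QLaguerre.weightMeasure q l),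
      ∃ Φ : QLaguerre.Hl q l (QLaguerre.admissible_of_quarter_le hq0 hq1 hl) ≃ₗᵢ[ℂ]
          Lp ℂ 2 (QLaguerre.weightMeasure q l),
        ∀ f : QLaguerre.Hl q l (QLaguerre.admissible_of_quarter_le hq0 hq1 hl),
          HasSum (fun n : ℕ => QLaguerre.bcoef q l n (f : ℂ⟦X⟧) • (hp n).toLp
            (fun t : ℝ => (QLaguerre.p q l n t : ℂ))) (Φ f) := by
  refine ⟨fun t ht x hx => QLaguerre.hasSum_xi hq0 hq1 hl ht hx, QLaguerre.memLp_p hq0 hq1 hl,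
    -- The isometry passes through ℓ²: coordinates in the basis f_n, then synthesis in the basis
    -- p_n.
    (QLaguerre.Hl.coordIso q l _).trans (QLaguerre.hilbertBasisP hq0 hq1 hl).repr.symm,
    fun f => ?_⟩
  have h := (QLaguerre.hilbertBasisP hq0 hq1 hl).hasSum_repr_symm
    (QLaguerre.Hl.coordIso q l (QLaguerre.admissible_of_quarter_le hq0 hq1 hl) f)
  rw [QLaguerre.hilbertBasisP, HilbertBasis.coe_mk] at h
  exact h
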